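/- All graphs are finite, simple and undirected. Let $\kappa\ge 1$ be an integer and $[\kappa]=\{1,\dots,\kappa\}$. For a vertex $v$ put $X_v=\{v\}\times[\kappa]$. A cover of a graph $G$ is a graph $H$ on $V(G)\times[\kappa]$ in which every edge joins $X_u$ to $X_v$ for some edge $uv$ of $G$, and in which, for each edge $uv$ of $G$, the edges between $X_u$ and $X_v$ form a (possibly empty) matching. A valued cover of $G$ is a pair $(H,f)$ with $H$ a cover of $G$ and $f:V(H)\to\{0,1,2,\dots\}$. A strictly $f$-degenerate transversal of $H$ is a set $R\subseteq V(H)$ with $|R\cap X_v|=1$ for every $v\in V(G)$ such that every nonempty subgraph $\Gamma$ of $H[R]$ has a vertex $x$ with $\deg_\Gamma(x)<f(x)$. The kernel of $(H,f)$ is the graph obtained from $H$ by deleting all vertices $x$ with $f(x)=0$. A valued cover $(H,f)$ of a graph $B$ is a building cover if $\sum_{q=1}^{\kappa}f(v,q)=\deg_B(v)$ for every $v\in V(B)$ and at least one of the following holds: 1. the kernel is isomorphic to $B$ (a monoblock); 2. $B\cong K_p$ for some $p\ge 2$, the kernel is isomorphic to the Cartesian product of $K_p$ with an independent set of some size $k$,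 and $f$ is constant on each component of the kernel; 3. $B\cong C_n$ with $n\ge 3$ odd, the kernel is isomorphic to the Cartesian product of $C_n$ with an independent set of size $2$, and $f= 1$ on the kernel; 4. $B\cong C_n$ with $n\ge 4$ even, the kernel is isomorphic to the graph on $[n]\times[2]$ in which $(i,j)$ is adjacent to $(i+1,j)$ for $1\le i\le n-1$, $j\in[2]$, and $(n,j)$ is adjacent to $(1,j')$ for $j\ne j'$, with no other edges, and $f= 1$ on the kernel. The class of constructible valued covers is the smallest class that contains all building covers and is closed under the following operation: given constructible valued covers $(H_1,f_1)$ of $G_1$ and $(H_2,f_2)$ of $G_2$ (on disjoint vertex sets, with the same $\kappa$) and vertices $w_i\in V(G_i)$, identify $w_1$ and $w_2$ to a new vertex $w$ to obtain $G$, identify $(w_1,q)$ with $(w_2,q)$ to $(w,q)$ for each $q\in[\kappa]$ to obtain $H$, and let $f(w,q)=f_1(w_1,q)+f_2(w_2,q)$ for $q\in[\kappa]$ and $f=f_i$ on $V(H_i)\setminus X_{w_i}$ for $i=1,2$. **Theorem.** Let $G$ be a connected graph and $(H,f)$ a valued cover of $G$ with $f$ not identically zero (this excludes only the case that $G$ has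 a single vertex and $f\equiv 0$) and $f(v,1)+\dots+f(v,\kappa)\ge\deg_G(v)$ for every $v\in V(G)$. Then $H$ has a strictly $f$-degenerate transversal if and only if $(H,f)$ is not constructible. -/

import Mathlib

namespace CoverDegeneracy

open scoped BigOperators

universe u

/-- The degree of a vertex (all graphs to which this is applied are finite). -/
noncomputable def deg {V : Type*} (G : SimpleGraph V) (v : V) : ℕ :=
  (G.neighborSet v).ncard

/-- `X_v = {(v, 1), …, (v, κ)}`; the colours are indexed by `Fin κ`. -/
def fiber {V : Type*} (κ : ℕ) (v : V) : Set (V × Fin κ) :=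
  {x | x.1 = v}

/-- `H` is a cover of `G`: every edge of `H` lies over an edge of `G`, and over each edge
`uv` of `G` the edges of `H` form a (possibly empty) matching between `X_u` and `X_v`. -/
structure IsCover {V : Type*} {κ : ℕ} (G : SimpleGraph V) (H : SimpleGraph (V × Fin κ)) :
    Prop where
  adj_base : ∀ x y, H.Adj x y → G.Adj x.1 y.1
  matching : ∀ x y z, H.Adj x y → H.Adj x z → y.1 = z.1 → y = z

/-- `G` is strictly `f`-degenerate: every nonempty subgraph `Γ` of `G` has a vertex `v`
with `deg_Γ(v) < f(v)`. -/
def StrictlyDegenerate {W : Type*} (G : SimpleGraph W) (f : W → ℕ) : Prop :=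
  ∀ Γ : G.Subgraph, Γ.verts.Nonempty → ∃ v ∈ Γ.verts, (Γ.neighborSet v).ncard < f v

/-- `R` is a transversal: `|R ∩ X_v| = 1` for every `v`. -/
def IsTransversal {V : Type*} {κ : ℕ} (R : Set (V × Fin κ)) : Prop :=
  ∀ v : V, (R ∩ fiber κ v).ncard = 1

/-- `R` is a strictly `f`-degenerate transversal of `H`: a transversal such that the induced
subgraph `H[R]` is strictly `f`-degenerate. -/
def IsStrictlyDegenerateTransversal {V : Type*} {κ : ℕ} (H : SimpleGraph (V × Fin κ))
    (f : V × Fin κ → ℕ) (R : Set (V × Fin κ)) : Prop :=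
  IsTransversal R ∧ StrictlyDegenerate (H.induce R) (fun x => f x.1)

/-- The vertices that survive in the kernel. -/
def support {W : Type*} (f : W → ℕ) : Set W := {x | f x ≠ 0}

/-- The kernel of `(H, f)`: delete from `H` all vertices with `f`-value `0`. -/
def kernel {W : Type*} (H : SimpleGraph W) (f : W → ℕ) : SimpleGraph (support f) :=
  H.induce (support f)

/-- `f` is constant on each component of the graph `H`. -/
def SemiConstant {W : Type*} (H : SimpleGraph W) (f : W → ℕ) : Prop :=
  ∀ x y, H.Reachable x y → f x = f y

/-- `K̃_p` with `k` layers: the Cartesian product of `K_p` and an independent `k`-set. -/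
def layeredComplete (p k : ℕ) : SimpleGraph (Fin p × Fin k) :=
  SimpleGraph.boxProd (⊤ : SimpleGraph (Fin p)) (⊥ : SimpleGraph (Fin k))

/-- The circular ladder graph `Γ_n`: the Cartesian product of the cycle `C_n` and an
independent set with two vertices. -/
def circularLadder (n : ℕ) : SimpleGraph (Fin n × Fin 2) :=
  SimpleGraph.boxProd (SimpleGraph.cycleGraph n) (⊥ : SimpleGraph (Fin 2))

/-- The Möbius ladder `M_n` (with first coordinates `0, …, n - 1`): `(i, j)` and `(i + 1, j)`
are adjacent, and `(n - 1, j)` and `(0, j')` are adjacent when `j ≠ j'`. -/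
def mobiusLadder (n : ℕ) : SimpleGraph (Fin n × Fin 2) :=
  SimpleGraph.fromRel fun x y =>
    (x.1.val + 1 = y.1.val ∧ x.2 = y.2) ∨
    (x.1.val + 1 = n ∧ y.1.val = 0 ∧ x.2 ≠ y.2)

/-- A monoblock (apart from the degree condition): the kernel is isomorphic to `B`. -/
def KernelIsBase {V : Type*} {κ : ℕ} (B : SimpleGraph V) (H : SimpleGraph (V × Fin κ))
    (f : V × Fin κ → ℕ) : Prop :=
  Nonempty (kernel H f ≃g B)

/-- `B` is a complete graph `K_p`, `p ≥ 2`, and the kernel is `K̃_p` (with some number `k` of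
layers), with `f` constant on each of its components. -/
def KernelIsLayeredComplete {V : Type*} {κ : ℕ} (B : SimpleGraph V)
    (H : SimpleGraph (V × Fin κ)) (f : V × Fin κ → ℕ) : Prop :=
  ∃ p k : ℕ, 2 ≤ p ∧ Nonempty (B ≃g (⊤ : SimpleGraph (Fin p))) ∧
    Nonempty (kernel H f ≃g layeredComplete p k) ∧
    SemiConstant (kernel H f) (fun x => f x.1)

/-- `B` is an odd cycle, and the kernel is the circular ladder, with `f ≡ 1` on it. -/
def KernelIsCircularLadder {V : Type*} {κ : ℕ} (B : SimpleGraph V)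
    (H : SimpleGraph (V × Fin κ)) (f : V × Fin κ → ℕ) : Prop :=
  ∃ n : ℕ, 3 ≤ n ∧ Odd n ∧ Nonempty (B ≃g SimpleGraph.cycleGraph n) ∧
    Nonempty (kernel H f ≃g circularLadder n) ∧ ∀ x ∈ support f, f x = 1

/-- `B` is an even cycle, and the kernel is the Möbius ladder, with `f ≡ 1` on it. -/
def KernelIsMobiusLadder {V : Type*} {κ : ℕ} (B : SimpleGraph V)
    (H : SimpleGraph (V × Fin κ)) (f : V × Fin κ → ℕ) : Prop :=
  ∃ n : ℕ, 3 ≤ n ∧ Even n ∧ Nonempty (B ≃g SimpleGraph.cycleGraph n) ∧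
    Nonempty (kernel H f ≃g mobiusLadder n) ∧ ∀ x ∈ support f, f x = 1

/-- `(H, f)` is a building cover of the finite graph `B`. -/
structure IsBuildingCover {V : Type*} {κ : ℕ} (B : SimpleGraph V)
    (H : SimpleGraph (V × Fin κ)) (f : V × Fin κ → ℕ) : Prop where
  finite : Finite V
  cover : IsCover B H
  degree : ∀ v : V, ∑ q : Fin κ, f (v, q) = deg B v
  type : KernelIsBase B H f ∨ KernelIsLayeredComplete B H f ∨
    KernelIsCircularLadder B H f ∨ KernelIsMobiusLadder B H f

/-- The embedding `V₁ × [κ] ↪ V × [κ]` induced by an embedding `V₁ ↪ V`. -/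
def liftEmb {V₁ V : Type*} (κ : ℕ) (e : V₁ ↪ V) : V₁ × Fin κ ↪ V × Fin κ :=
  e.prodMap (Function.Embedding.refl (Fin κ))

/-- Constructible valued covers `(H, f)` of `G`. In `glue`, the vertex set `V` is the union of
copies of `V₁` and `V₂` (embedded by `e₁` and `e₂`) that meet exactly in the vertex
`w = e₁ w₁ = e₂ w₂`; `G` and `H` are the unions of the two copies, and
`f = f₁ + f₂` on `X_w`, `f = fᵢ` on the copy of `Hᵢ - X_w`. -/
inductive Constructible {κ : ℕ} : {V : Type u} → SimpleGraph V → SimpleGraph (V × Fin κ) →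
    (V × Fin κ → ℕ) → Prop
  | building {V : Type u} {B : SimpleGraph V} {H : SimpleGraph (V × Fin κ)}
      {f : V × Fin κ → ℕ} (h : IsBuildingCover B H f) : Constructible B H f
  | glue {V₁ V₂ V : Type u}
      {G₁ : SimpleGraph V₁} {H₁ : SimpleGraph (V₁ × Fin κ)} {f₁ : V₁ × Fin κ → ℕ}
      {G₂ : SimpleGraph V₂} {H₂ : SimpleGraph (V₂ × Fin κ)} {f₂ : V₂ × Fin κ → ℕ}
      {G : SimpleGraph V} {H : SimpleGraph (V × Fin κ)} {f : V × Fin κ → ℕ}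
      (w₁ : V₁) (w₂ : V₂) (w : V) (e₁ : V₁ ↪ V) (e₂ : V₂ ↪ V)
      (h₁ : Constructible G₁ H₁ f₁) (h₂ : Constructible G₂ H₂ f₂)
      (hw₁ : e₁ w₁ = w) (hw₂ : e₂ w₂ = w)
      (hunion : Set.range e₁ ∪ Set.range e₂ = Set.univ)
      (hinter : Set.range e₁ ∩ Set.range e₂ = {w})
      (hG : G = G₁.map e₁ ⊔ G₂.map e₂)
      (hH : H = H₁.map (liftEmb κ e₁) ⊔ H₂.map (liftEmb κ e₂))
      (hfw : ∀ q, f (w, q) = f₁ (w₁, q) + f₂ (w₂, q))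
      (hf₁ : ∀ v q, v ≠ w₁ → f (e₁ v, q) = f₁ (v, q))
      (hf₂ : ∀ v q, v ≠ w₂ → f (e₂ v, q) = f₂ (v, q)) : Constructible G H f

end CoverDegeneracy

namespace CoverDegeneracy

open Finset
open scoped Classical

universe u

variable {V : Type*} {κ : ℕ}

/-! A chosen vertex over `u` costs a neighbour of `u` at most one unit of value, in the one colour
matched to it. So if every component has a vertex with slack in the degree condition, a greedy
choice ending there succeeds (`colorable_of_strict`). A connected configuration without transversal
(`Crit`) is therefore tight, a partial transversal with connected remainder leaves a critical
residue (`Crit.residual`), and a transversal over all vertices but `v` blocks each colour of `v`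
exactly as often as its value (`Crit.cnt_eq`). The structure comes from comparing residues of
different partial transversals.

At a cut vertex the values split into the amounts blocked from the two sides, so a critical
configuration is glued from two smaller ones (`Crit.exists_split`). In a block, positive colours are
matched to positive colours along every edge (`Crit.exists_match`). Hence either each vertex has one
positive colour and the kernel is a copy of the block, or all vertices have at least two. In the
second case a shortest path whose ends block different colours of `v` closes up to an induced cycle
with a two-coloured residue (`Crit.exists_cyc`). Over cliques and induced cycles such critical
values agree along kernel edges (`Uniform`). A suitable attachment to a uniform block would let the
value at one vertex vary while a neighbouring value stays fixed (`Crit.no_attachment`), so a proper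
uniform block with a two-coloured residue is completely joined to a further vertex
(`Crit.exists_join`). This makes the whole block complete or a cycle (`Crit.isClique_or_cyc`).
Transitivity of the matchings then gives the layers over a clique, and parity selects the ladder
over a cycle.

Conversely, building covers have no transversal: by edge counting, by a pigeonhole over layers, or
by independence in cycles. Gluing preserves this because bad sets of the two sides can be united at
the common vertex (`not_good_glue`). -/

/-- The number of `u ∈ A` whose chosen vertex `(u, φ u)` is adjacent to `(v, q)`. -/
noncomputable def cnt (H : SimpleGraph (V × Fin κ)) (φ : V → Fin κ) (A : Finset V) (v : V)
    (q : Fin κ) : ℕ :=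
  #{u ∈ A | H.Adj (v, q) (u, φ u)}

/-- The number of neighbours of `v` in `A`. -/
noncomputable def dg (G : SimpleGraph V) (A : Finset V) (v : V) : ℕ :=
  #{u ∈ A | G.Adj v u}

/-- The choice `φ` induces a strictly `g`-degenerate graph over `S`. -/
def Good (H : SimpleGraph (V × Fin κ)) (g : V × Fin κ → ℕ) (φ : V → Fin κ) (S : Finset V) :
    Prop :=
  ∀ A ⊆ S, A.Nonempty → ∃ v ∈ A, cnt H φ A v (φ v) < g (v, φ v)

/-- There is a strictly `g`-degenerate transversal over `S`. -/
def Colorable (H : SimpleGraph (V × Fin κ)) (g : V × Fin κ → ℕ) (S : Finset V) : Prop :=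
  ∃ φ, Good H g φ S

/-- The values that remain after the vertices over `T` have been chosen. -/
noncomputable def res (H : SimpleGraph (V × Fin κ)) (g : V × Fin κ → ℕ) (φ : V → Fin κ)
    (T : Finset V) : V × Fin κ → ℕ :=
  fun x => g x - cnt H φ T x.1 x.2

/-- The degree condition over `S`. -/
def Valid (G : SimpleGraph V) (g : V × Fin κ → ℕ) (S : Finset V) : Prop :=
  ∀ v ∈ S, dg G S v ≤ ∑ q, g (v, q)

/-- `S` induces a connected subgraph, expressed by cuts. -/
def Conn (G : SimpleGraph V) (S : Finset V) : Prop :=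
  S.Nonempty ∧ ∀ A ⊆ S, A.Nonempty → A ≠ S → ∃ a ∈ A, ∃ b ∈ S, b ∉ A ∧ G.Adj a b

/-- `S` induces a connected subgraph without cut vertices, with at least two vertices. -/
def Block (G : SimpleGraph V) (S : Finset V) : Prop :=
  Conn G S ∧ ∀ v ∈ S, Conn G (S.erase v)

/-- `S` is connected, satisfies the degree condition, and has no transversal. -/
structure Crit (G : SimpleGraph V) (H : SimpleGraph (V × Fin κ)) (g : V × Fin κ → ℕ)
    (S : Finset V) : Prop where
  conn : Conn G S
  valid : Valid G g S
  bad : ¬ Colorable H g S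

/-- At least two colours have a positive value at `v`. -/
def Two (g : V × Fin κ → ℕ) (v : V) : Prop :=
  ∃ q₁ q₂, q₁ ≠ q₂ ∧ 0 < g (v, q₁) ∧ 0 < g (v, q₂)

variable {G : SimpleGraph V} {H : SimpleGraph (V × Fin κ)} {g : V × Fin κ → ℕ}
  {φ ψ : V → Fin κ} {S T A : Finset V} {u v w : V} {q : Fin κ}

/-! ### Counting for partial transversals. -/

theorem IsCover.eq_of_adj (hc : IsCover G H) {x : V × Fin κ} {v : V} {q q' : Fin κ}
    (h : H.Adj x (v, q)) (h' : H.Adj x (v, q')) : q = q' :=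
  congrArg Prod.snd (hc.matching x (v, q) (v, q') h h' rfl)

theorem IsCover.eq_of_adj' (hc : IsCover G H) {x : V × Fin κ} {v : V} {q q' : Fin κ}
    (h : H.Adj (v, q) x) (h' : H.Adj (v, q') x) : q = q' :=
  hc.eq_of_adj h.symm h'.symm

theorem IsCover.base (hc : IsCover G H) {u v : V} {q q' : Fin κ}
    (h : H.Adj (u, q) (v, q')) : G.Adj u v :=
  hc.adj_base _ _ h

theorem cnt_congr (h : ∀ u ∈ A, φ u = ψ u) (v : V) (q : Fin κ) :
    cnt H φ A v q = cnt H ψ A v q := by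
  unfold cnt
  congr 1
  apply Finset.filter_congr
  intro u hu
  rw [h u hu]

theorem cnt_mono (h : A ⊆ S) (v : V) (q : Fin κ) : cnt H φ A v q ≤ cnt H φ S v q :=
  Finset.card_le_card (Finset.filter_subset_filter _ h)

theorem cnt_union (h : Disjoint A T) (v : V) (q : Fin κ) :
    cnt H φ (A ∪ T) v q = cnt H φ A v q + cnt H φ T v q := by
  unfold cnt
  rw [Finset.filter_union, Finset.card_union_of_disjoint]
  exact Finset.disjoint_filter_filter h

theorem cnt_singleton (u v : V) (q : Fin κ) :
    cnt H φ {u} v q = if H.Adj (v, q) (u, φ u) then 1 else 0 := by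
  unfold cnt
  rw [Finset.filter_singleton]
  split_ifs <;> simp

theorem cnt_erase (hu : u ∈ A) (v : V) (q : Fin κ) :
    cnt H φ A v q = cnt H φ (A.erase u) v q + if H.Adj (v, q) (u, φ u) then 1 else 0 := by
  have h : A.erase u ∪ {u} = A := by
    rw [Finset.union_comm, ← Finset.insert_eq, Finset.insert_erase hu]
  conv_lhs => rw [← h, cnt_union (by simp), cnt_singleton]

theorem dg_union (h : Disjoint A T) (v : V) : dg G (A ∪ T) v = dg G A v + dg G T v := by
  unfold dg
  rw [Finset.filter_union, Finset.card_union_of_disjoint]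
  exact Finset.disjoint_filter_filter h

theorem dg_mono (h : A ⊆ S) (v : V) : dg G A v ≤ dg G S v :=
  Finset.card_le_card (Finset.filter_subset_filter _ h)

theorem dg_lt (h : A ⊆ S) (hu : u ∈ S) (hu' : u ∉ A) (ha : G.Adj v u) : dg G A v < dg G S v := by
  apply Finset.card_lt_card
  refine ⟨Finset.filter_subset_filter _ h, fun h' => hu' ?_⟩
  exact (Finset.mem_filter.1 (h' (Finset.mem_filter.2 ⟨hu, ha⟩))).1

theorem cnt_eq_zero (h : ∀ u ∈ A, ¬ H.Adj (v, q) (u, φ u)) : cnt H φ A v q = 0 := by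
  unfold cnt
  rw [Finset.card_eq_zero, Finset.filter_eq_empty_iff]
  exact h

theorem cnt_pos (hu : u ∈ A) (h : H.Adj (v, q) (u, φ u)) : 0 < cnt H φ A v q :=
  Finset.card_pos.2 ⟨u, Finset.mem_filter.2 ⟨hu, h⟩⟩

theorem exists_of_cnt_pos (h : 0 < cnt H φ A v q) : ∃ u ∈ A, H.Adj (v, q) (u, φ u) := by
  obtain ⟨u, hu⟩ := Finset.card_pos.1 h
  exact ⟨u, Finset.mem_filter.1 hu⟩

theorem sum_cnt_eq (φ : V → Fin κ) (A : Finset V) (v : V) :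
    ∑ q, cnt H φ A v q = ∑ u ∈ A, #{q : Fin κ | H.Adj (v, q) (u, φ u)} := by
  simp only [cnt, Finset.card_filter]
  exact Finset.sum_comm

/-- By the matching property a chosen vertex over `u` is adjacent to at most one colour of `v`, and
to none if `u` is not a neighbour of `v`. -/
theorem sum_cnt_le (hc : IsCover G H) (φ : V → Fin κ) (A : Finset V) (v : V) :
    ∑ q, cnt H φ A v q ≤ dg G A v := by
  rw [sum_cnt_eq, dg, Finset.card_filter]
  apply Finset.sum_le_sum
  intro u _
  split_ifs with h
  · rw [Finset.card_le_one]
    intro a ha b hb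
    exact hc.eq_of_adj' (Finset.mem_filter.1 ha).2 (Finset.mem_filter.1 hb).2
  · rw [Nat.le_zero, Finset.card_eq_zero, Finset.filter_eq_empty_iff]
    intro q _ hq
    exact h (hc.base hq)

theorem Good.mono (h : Good H g φ S) (hA : A ⊆ S) : Good H g φ A :=
  fun B hB => h B (hB.trans hA)

theorem Good.pos (h : Good H g φ S) (hv : v ∈ S) : 0 < g (v, φ v) := by
  obtain ⟨u, hu, h'⟩ := h {v} (by simpa using hv) (by simp)
  obtain rfl := Finset.mem_singleton.1 hu
  omega

theorem Good.congr (h : Good H g φ S) (h' : ∀ u ∈ S, φ u = ψ u) : Good H g ψ S := by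
  intro A hA hne
  obtain ⟨v, hv, hlt⟩ := h A hA hne
  refine ⟨v, hv, ?_⟩
  rw [← h' v (hA hv), ← cnt_congr (fun u hu => h' u (hA hu))]
  exact hlt

theorem good_singleton (h : 0 < g (v, φ v)) : Good H g φ {v} := by
  intro A hA hne
  obtain rfl : A = {v} := hne.subset_singleton_iff.1 hA
  refine ⟨v, by simp, ?_⟩
  simpa [cnt_singleton] using h

theorem good_empty : Good H g φ ∅ := by
  intro A hA hne
  simp [Finset.subset_empty.1 hA] at hne

/-- A set meeting `S` is tested on its part in `S`, where the neighbours over `T` are already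
deducted; a set avoiding `S` lies in `T`. -/
theorem Good.union_res (h₁ : Good H g φ T) (h₂ : Good H (res H g φ T) φ S) :
    Good H g φ (T ∪ S) := by
  intro A hA hne
  by_cases h : (A ∩ S).Nonempty
  · obtain ⟨v, hv, hlt⟩ := h₂ (A ∩ S) Finset.inter_subset_right h
    refine ⟨v, (Finset.mem_inter.1 hv).1, ?_⟩
    have h3 : cnt H φ A v (φ v) ≤ cnt H φ (A ∩ S) v (φ v) + cnt H φ T v (φ v) := by
      unfold cnt
      refine le_trans (Finset.card_le_card ?_) (Finset.card_union_le _ _)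
      intro u hu
      have := hA (Finset.mem_filter.1 hu).1
      simp only [Finset.mem_union, Finset.mem_filter, Finset.mem_inter] at *
      tauto
    simp only [res] at hlt
    omega
  · refine h₁ A (fun u hu => ?_) hne
    rcases Finset.mem_union.1 (hA hu) with h' | h'
    · exact h'
    · exact absurd ⟨u, Finset.mem_inter.2 ⟨hu, h'⟩⟩ h

theorem Good.piecewise (hd : Disjoint T S) (h₁ : Good H g φ T)
    (h₂ : Good H (res H g φ T) ψ S) : Good H g (fun v => if v ∈ S then ψ v else φ v) (T ∪ S) := by
  have hT : ∀ u ∈ T, φ u = (fun v => if v ∈ S then ψ v else φ v) u := by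
    intro u hu
    simp [Finset.disjoint_left.1 hd hu]
  apply Good.union_res (h₁.congr hT)
  have : res H g (fun v => if v ∈ S then ψ v else φ v) T = res H g φ T := by
    funext x
    simp only [res]
    rw [cnt_congr hT]
  rw [this]
  apply h₂.congr
  intro u hu
  simp [hu]

theorem Good.insert_last (h : Good H g φ T) (hv : v ∉ T) (hq : cnt H φ T v q < g (v, q)) :
    Good H g (Function.update φ v q) (insert v T) := by
  have hT : ∀ u ∈ T, φ u = Function.update φ v q u := by
    intro u hu
    rw [Function.update_of_ne]
    rintro rfl
    exact hv hu
  rw [Finset.insert_eq, Finset.union_comm]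
  apply Good.union_res (h.congr hT)
  apply good_singleton
  simp only [res, Function.update_self]
  rw [← cnt_congr hT]
  omega

/-! ### Greedy choices and critical configurations. -/

/-- A vertex `v` with slack is coloured last. Removing it gives slack to its neighbours, and a
closed part of the rest without neighbour of `v` was already closed in `S`, so the hypothesis is
inherited. -/
theorem colorable_of_strict [Nonempty (Fin κ)] (hc : IsCover G H) (g : V × Fin κ → ℕ) (S : Finset V)
    (hval : Valid G g S)
    (hstrict : ∀ A ⊆ S, A.Nonempty → (∀ a ∈ A, ∀ b ∈ S, b ∉ A → ¬ G.Adj a b) →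
      ∃ v ∈ A, dg G S v < ∑ q, g (v, q)) : Colorable H g S := by
  induction S using Finset.strongInduction with
  | H S ih =>
  rcases S.eq_empty_or_nonempty with rfl | hne
  · exact ⟨fun _ => Classical.arbitrary _, good_empty⟩
  obtain ⟨v, hv, hlt⟩ := hstrict S subset_rfl hne (fun a _ b hb hb' => absurd hb hb')
  obtain ⟨φ, hφ⟩ := ih (S.erase v) (Finset.erase_ssubset hv)
    (fun u hu => (dg_mono (Finset.erase_subset _ _) u).trans
      (hval u (Finset.mem_of_mem_erase hu))) (by
    intro A hA hAne hcl
    by_cases h : ∃ a ∈ A, G.Adj a v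
    · obtain ⟨a, ha, hav⟩ := h
      exact ⟨a, ha, (dg_lt (Finset.erase_subset _ _) hv (by simp) hav).trans_le
        (hval a (Finset.mem_of_mem_erase (hA ha)))⟩
    · push Not at h
      obtain ⟨a, ha, hlt⟩ := hstrict A (hA.trans (Finset.erase_subset _ _)) hAne (by
        intro a ha b hb hb'
        by_cases hbv : b = v
        · exact hbv ▸ h a ha
        · exact hcl a ha b (Finset.mem_erase.2 ⟨hbv, hb⟩) hb')
      exact ⟨a, ha, (dg_mono (Finset.erase_subset _ _) a).trans_lt hlt⟩)
  have : ∃ q, cnt H φ (S.erase v) v q < g (v, q) := by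
    by_contra! hcon
    have h1 : ∑ q, g (v, q) ≤ ∑ q, cnt H φ (S.erase v) v q :=
      Finset.sum_le_sum fun q _ => hcon q
    have h2 := sum_cnt_le hc φ (S.erase v) v
    have h3 : dg G (S.erase v) v ≤ dg G S v := dg_mono (Finset.erase_subset _ _) v
    omega
  obtain ⟨q, hq⟩ := this
  have := hφ.insert_last (by simp) hq
  rw [Finset.insert_erase hv] at this
  exact ⟨_, this⟩

/-- If `S` is connected, a nonempty part of it may be left for the end. -/
theorem Conn.colorable_sdiff [Nonempty (Fin κ)] (hS : Conn G S) (hc : IsCover G H)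
    (hval : Valid G g S) (hA : A ⊆ S) (hne : A.Nonempty) : Colorable H g (S \ A) := by
  apply colorable_of_strict hc
  · exact fun v hv => (dg_mono Finset.sdiff_subset v).trans (hval v (Finset.sdiff_subset hv))
  · intro B hB hBne hcl
    obtain ⟨a, ha, b, hb, hbB, hab⟩ := hS.2 B (hB.trans Finset.sdiff_subset) hBne (by
      rintro rfl
      obtain ⟨x, hx⟩ := hne
      exact (Finset.mem_sdiff.1 (hB (hA hx))).2 hx)
    have hbA : b ∈ A := by
      by_contra h
      exact hcl a ha b (Finset.mem_sdiff.2 ⟨hb, h⟩) hbB hab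
    exact ⟨a, ha, (dg_lt Finset.sdiff_subset hb (by simp [hbA]) hab).trans_le
      (hval a (Finset.sdiff_subset (hB ha)))⟩

/-- Each neighbour in `T` takes one from the available degree and at most one from the total value.
-/
theorem Valid.residual (hc : IsCover G H) (hval : Valid G g S) (hd : Disjoint T A) (h : T ∪ A ⊆ S)
    (φ : V → Fin κ) : Valid G (res H g φ T) A := by
  intro v hv
  have h1 := hval v (h (Finset.mem_union_right _ hv))
  have h2 := sum_cnt_le hc φ T v
  have h3 : dg G T v + dg G A v ≤ dg G S v := by
    rw [← dg_union hd]
    exact dg_mono h v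
  have h4 : ∑ q, g (v, q) ≤ ∑ q, res H g φ T (v, q) + ∑ q, cnt H φ T v q := by
    rw [← Finset.sum_add_distrib]
    apply Finset.sum_le_sum
    intro q _
    simp only [res]
    omega
  omega

theorem Crit.residual (hc : IsCover G H) (h : Crit G H g S) (hA : A ⊆ S) (hconn : Conn G A)
    (hφ : Good H g φ (S \ A)) : Crit G H (res H g φ (S \ A)) A where
  conn := hconn
  valid := h.valid.residual hc Finset.sdiff_disjoint (Finset.union_subset Finset.sdiff_subset hA) φ
  bad := by
    rintro ⟨ψ, hψ⟩
    apply h.bad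
    have := hφ.piecewise Finset.sdiff_disjoint hψ
    rw [Finset.sdiff_union_of_subset hA] at this
    exact ⟨_, this⟩

/-- In a critical configuration the degree condition is tight. -/
theorem Crit.sum_eq [Nonempty (Fin κ)] (hc : IsCover G H) (h : Crit G H g S) (hv : v ∈ S) :
    ∑ q, g (v, q) = dg G S v := by
  by_contra hne
  have hlt : dg G S v < ∑ q, g (v, q) := lt_of_le_of_ne (h.valid v hv) (Ne.symm hne)
  apply h.bad
  apply colorable_of_strict hc _ _ h.valid
  intro A hA hAne hcl
  by_cases hAS : A = S
  · exact ⟨v, hAS ▸ hv, hlt⟩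
  · obtain ⟨a, ha, b, hb, hb', hab⟩ := h.conn.2 A hA hAne hAS
    exact absurd hab (hcl a ha b hb hb')

/-- A transversal over all but one vertex blocks every colour of that vertex exactly. -/
theorem Crit.cnt_eq (hc : IsCover G H) (h : Crit G H g S) (hv : v ∈ S)
    (hφ : Good H g φ (S.erase v)) (q : Fin κ) : cnt H φ (S.erase v) v q = g (v, q) := by
  have hle : ∀ q ∈ (univ : Finset (Fin κ)), g (v, q) ≤ cnt H φ (S.erase v) v q := by
    intro q _
    by_contra! hlt
    apply h.bad
    have := hφ.insert_last (by simp) hlt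
    rw [Finset.insert_erase hv] at this
    exact ⟨_, this⟩
  have hsum : ∑ q, g (v, q) = ∑ q, cnt H φ (S.erase v) v q := by
    apply le_antisymm (Finset.sum_le_sum hle)
    exact (sum_cnt_le hc φ _ v).trans ((dg_mono (Finset.erase_subset _ _) v).trans (h.valid v hv))
  exact (((Finset.sum_eq_sum_iff_of_le hle).1 hsum) q (Finset.mem_univ q)).symm

/-- With a transversal over all but one vertex `v`, each neighbour of `v` blocks a colour. -/
theorem Crit.exists_adj (hc : IsCover G H) (h : Crit G H g S) (hv : v ∈ S)
    (hφ : Good H g φ (S.erase v)) (hu : u ∈ S) (huv : G.Adj v u) :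
    ∃ q, H.Adj (v, q) (u, φ u) := by
  by_contra! hcon
  have h0 := h.valid v hv
  have h1 : ∑ q, g (v, q) = ∑ q, cnt H φ (S.erase v) v q :=
    Finset.sum_congr rfl fun q _ => (h.cnt_eq hc hv hφ q).symm
  have h2 : ∑ q, cnt H φ (S.erase v) v q = ∑ q, cnt H φ ((S.erase v).erase u) v q := by
    apply Finset.sum_congr rfl
    intro q _
    rw [cnt_erase (Finset.mem_erase.2 ⟨huv.ne', hu⟩), if_neg (hcon q), add_zero]
  have h3 := sum_cnt_le hc φ ((S.erase v).erase u) v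
  have h4 : dg G ((S.erase v).erase u) v < dg G S v :=
    dg_lt ((Finset.erase_subset _ _).trans (Finset.erase_subset _ _)) hu (by simp) huv
  omega

/-- Over each edge at a vertex `v` that is not a cut vertex, each vertex of the kernel over `v`
has a neighbour in the kernel. -/
theorem Crit.exists_match [Nonempty (Fin κ)] (hc : IsCover G H) (h : Crit G H g S)
    (hv : v ∈ S) (hconn : Conn G (S.erase v)) (hu : u ∈ S) (huv : G.Adj v u)
    (hq : 0 < g (v, q)) : ∃ q', H.Adj (v, q) (u, q') ∧ 0 < g (u, q') := by
  by_contra! hcon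
  have hSe : S \ S.erase v = {v} := Finset.sdiff_erase_self hv
  have hg : Good H g (fun _ => q) (S \ S.erase v) := by
    rw [hSe]
    exact good_singleton hq
  have h1 := (h.residual hc (Finset.erase_subset v S) hconn hg).sum_eq hc
    (Finset.mem_erase.2 ⟨huv.ne', hu⟩)
  have h2 := h.valid u hu
  have h3 : dg G (S.erase v) u < dg G S u :=
    dg_lt (Finset.erase_subset _ _) hv (by simp) huv.symm
  -- With `q` chosen at `v`, only colours of value 0 at `u` are hit, and truncated subtraction
  -- leaves them alone. So `u` keeps its total while its degree drops, against tightness of the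
  -- residue.
  have h4 : ∀ q' ∈ (univ : Finset (Fin κ)),
      res H g (fun _ => q) (S \ S.erase v) (u, q') = g (u, q') := by
    intro q' _
    simp only [res]
    rw [hSe, cnt_singleton]
    split_ifs with h'
    · have := hcon q' h'.symm
      omega
    · rfl
  rw [Finset.sum_congr rfl h4] at h1
  omega

/-! ### Connectivity, and propagation of two positive colours. -/

theorem Conn.induction (hS : Conn G S) {P : V → Prop} (hu : u ∈ S) (hP : P u)
    (hstep : ∀ a ∈ S, ∀ b ∈ S, G.Adj a b → P a → P b) (hv : v ∈ S) : P v := by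
  by_contra hv'
  obtain ⟨a, ha, b, hb, hb', hab⟩ := hS.2 {x ∈ S | P x} (Finset.filter_subset _ _)
    ⟨u, Finset.mem_filter.2 ⟨hu, hP⟩⟩ (fun h => hv' (Finset.mem_filter.1 (h ▸ hv)).2)
  obtain ⟨ha, haP⟩ := Finset.mem_filter.1 ha
  exact hb' (Finset.mem_filter.2 ⟨hb, hstep a ha b hb hab haP⟩)

theorem Crit.two_of_adj [Nonempty (Fin κ)] (hc : IsCover G H) (h : Crit G H g S)
    (hv : v ∈ S) (hconn : Conn G (S.erase v)) (hu : u ∈ S) (huv : G.Adj v u) (ht : Two g v) :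
    Two g u := by
  obtain ⟨q₁, q₂, hne, h₁, h₂⟩ := ht
  obtain ⟨r₁, hr₁, h₁'⟩ := h.exists_match hc hv hconn hu huv h₁
  obtain ⟨r₂, hr₂, h₂'⟩ := h.exists_match hc hv hconn hu huv h₂
  refine ⟨r₁, r₂, ?_, h₁', h₂'⟩
  rintro rfl
  exact hne (hc.eq_of_adj' hr₁ hr₂)

theorem Crit.two [Nonempty (Fin κ)] (hc : IsCover G H) (h : Crit G H g S) (hb : Block G S)
    (hv : v ∈ S) (hu : u ∈ S) (ht : Two g v) : Two g u :=
  hb.1.induction (P := Two g) hv ht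
    (fun a ha _ hb' hab hta => h.two_of_adj hc ha (hb.2 a ha) hb' hab hta) hu

theorem res_le (g : V × Fin κ → ℕ) (φ : V → Fin κ) (T : Finset V) (x : V × Fin κ) :
    res H g φ T x ≤ g x :=
  Nat.sub_le _ _

theorem Two.mono {g' : V × Fin κ → ℕ} (h : Two g v) (hle : ∀ x, g x ≤ g' x) : Two g' v := by
  obtain ⟨q₁, q₂, hne, h₁, h₂⟩ := h
  exact ⟨q₁, q₂, hne, h₁.trans_le (hle _), h₂.trans_le (hle _)⟩

/-- A set with no edge leaving it contains each part that it meets, and the common vertex or joining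
edge carries it to the other part. -/
theorem Conn.union (hS : Conn G S) (hT : Conn G T) (h : ∃ u ∈ S, ∃ v ∈ T, u = v ∨ G.Adj u v) :
    Conn G (S ∪ T) := by
  obtain ⟨u, hu, v, hv, huv⟩ := h
  refine ⟨hS.1.mono Finset.subset_union_left, ?_⟩
  intro A hA hne hAne
  by_contra! hcon
  have key : ∀ R ⊆ S ∪ T, Conn G R → (R ∩ A).Nonempty → R ⊆ A := by
    intro R hRS hR ⟨x, hx⟩ y hy
    obtain ⟨hxR, hxA⟩ := Finset.mem_inter.1 hx
    exact hR.induction (P := fun z => z ∈ A) hxR hxA (fun a ha b hb hab haA => by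
      by_contra hbA
      exact hcon a haA b (hRS hb) hbA hab) hy
  have hSA : S ⊆ A ∨ T ⊆ A := by
    obtain ⟨x, hx⟩ := hne
    rcases Finset.mem_union.1 (hA hx) with h | h
    · exact Or.inl (key S Finset.subset_union_left hS ⟨x, Finset.mem_inter.2 ⟨h, hx⟩⟩)
    · exact Or.inr (key T Finset.subset_union_right hT ⟨x, Finset.mem_inter.2 ⟨h, hx⟩⟩)
  have huvA : u ∈ A ∧ v ∈ A := by
    rcases huv with rfl | huv
    · rcases hSA with h | h
      · exact ⟨h hu, h hu⟩
      · exact ⟨h hv, h hv⟩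
    · rcases hSA with h | h
      · refine ⟨h hu, ?_⟩
        by_contra hvA
        exact hcon u (h hu) v (Finset.mem_union_right _ hv) hvA huv
      · refine ⟨?_, h hv⟩
        by_contra huA
        exact hcon v (h hv) u (Finset.mem_union_left _ hu) huA huv.symm
  apply hAne
  apply hA.antisymm
  apply Finset.union_subset
  · exact key S Finset.subset_union_left hS ⟨u, Finset.mem_inter.2 ⟨hu, huvA.1⟩⟩
  · exact key T Finset.subset_union_right hT ⟨v, Finset.mem_inter.2 ⟨hv, huvA.2⟩⟩

theorem conn_singleton (v : V) : Conn G {v} := by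
  refine ⟨by simp, fun A hA hne h => absurd ?_ h⟩
  exact hne.subset_singleton_iff.1 hA

/-- The set of vertices of a walk is connected. -/
theorem conn_image_range (p : ℕ → V) (n : ℕ) (h : ∀ i < n, G.Adj (p i) (p (i + 1))) :
    Conn G ((Finset.range (n + 1)).image p) := by
  induction n with
  | zero => simpa using conn_singleton _
  | succ n ih =>
    rw [Finset.range_add_one, Finset.image_insert, Finset.insert_eq]
    apply (conn_singleton _).union (ih fun i hi => h i (by omega))
    exact ⟨_, by simp, p n, Finset.mem_image_of_mem _ (by simp), Or.inr (h n (by omega)).symm⟩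

/-- In a connected set with at least two vertices each vertex has a neighbour. -/
theorem Conn.exists_adj (hS : Conn G S) (hv : v ∈ S) (hne : S ≠ {v}) :
    ∃ u ∈ S, G.Adj v u := by
  obtain ⟨a, ha, b, hb, -, hab⟩ := hS.2 {v} (by simpa using hv) (by simp) (Ne.symm hne)
  obtain rfl := Finset.mem_singleton.1 ha
  exact ⟨b, hb, hab⟩

/-- A partial transversal over `T` extends to all of `S` but a part `A` of the connected
remainder `S \ T`. -/
theorem Good.exists_extend [Nonempty (Fin κ)] (hc : IsCover G H) (hval : Valid G g S)
    (hφ : Good H g φ T) (hT : T ⊆ S) (hconn : Conn G (S \ T)) (hA : A ⊆ S \ T)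
    (hne : A.Nonempty) : ∃ ψ, Good H g ψ (S \ A) ∧ ∀ u ∈ T, ψ u = φ u := by
  have hval' : Valid G (res H g φ T) (S \ T) :=
    hval.residual hc Finset.disjoint_sdiff (Finset.union_subset hT Finset.sdiff_subset) φ
  obtain ⟨ψ, hψ⟩ := hconn.colorable_sdiff hc hval' hA hne
  have hd : Disjoint T ((S \ T) \ A) := Finset.disjoint_sdiff.mono_right Finset.sdiff_subset
  refine ⟨_, (hφ.piecewise hd hψ).mono ?_, ?_⟩
  · intro x hx
    simp only [Finset.mem_union, Finset.mem_sdiff] at hx ⊢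
    tauto
  · intro u hu
    rw [if_neg (Finset.disjoint_left.1 hd hu)]

/-! ### Attachments to a uniform block. -/

/-- In every critical configuration over `A` with two colours at some vertex, the values agree
along the edges of the kernel. -/
def Uniform (G : SimpleGraph V) (H : SimpleGraph (V × Fin κ)) (A : Finset V) : Prop :=
  ∀ g, Crit G H g A → (∃ a ∈ A, Two g a) → ∀ x ∈ A, ∀ y ∈ A, ∀ q q', H.Adj (x, q) (y, q') →
    0 < g (x, q) → 0 < g (y, q') → g (x, q) = g (y, q')

/-- The vertex `w` has two colours, which give two residues on `A`. The one matched to `(u, s)`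
lowers the value there by one, the other does not, while the value at `(y, r)`, matched to `(u, s)`,
is untouched because `y` has no neighbour in `P`. `Uniform` would equate both values at `(u, s)`
with that one value. -/
theorem Crit.no_attachment [Nonempty (Fin κ)] (hc : IsCover G H) (h : Crit G H g S)
    (hA : Block G A) (hAS : A ⊆ S) (hU : Uniform G H A) (hφ : Good H g φ (S \ A))
    {a : V} (ha : a ∈ A) (hta : Two (res H g φ (S \ A)) a) {P : Finset V} (hP : P ⊆ S \ A)
    {w u y : V} (hw : w ∈ P) (hu : u ∈ A) (hy : y ∈ A) (huy : G.Adj u y)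
    (hyP : ∀ p ∈ P, ¬ G.Adj y p) (huP : ∀ p ∈ P, G.Adj u p ↔ p = w)
    (h₁ : Conn G (A ∪ P)) (h₂ : Conn G ((A ∪ P).erase u)) (h₃ : Conn G ((A ∪ P).erase w)) :
    False := by
  have hd : Disjoint A P := Finset.disjoint_sdiff.mono_right hP
  have hwA : w ∉ A := Finset.disjoint_right.1 hd hw
  have hS₁ : A ∪ P ⊆ S := Finset.union_subset hAS (hP.trans Finset.sdiff_subset)
  have hsub : S \ (A ∪ P) ⊆ S \ A := Finset.sdiff_subset_sdiff subset_rfl Finset.subset_union_left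
  have hg₁ := h.residual hc hS₁ h₁ (hφ.mono hsub)
  set g₁ := res H g φ (S \ (A ∪ P)) with hg₁def
  have hle : ∀ x, res H g φ (S \ A) x ≤ g₁ x := by
    intro x
    have := cnt_mono (H := H) (φ := φ) hsub x.1 x.2
    simp only [hg₁def, res]
    omega
  have hkA := h.residual hc hAS hA.1 hφ
  have htA : ∀ b ∈ A, Two g₁ b := fun b hb => (hkA.two hc hA ha hb hta).mono hle
  have hwS : w ∈ A ∪ P := Finset.mem_union_right _ hw
  have huS : u ∈ A ∪ P := Finset.mem_union_left _ hu
  have hyS : y ∈ A ∪ P := Finset.mem_union_left _ hy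
  have huw : G.Adj u w := (huP w hw).2 rfl
  obtain ⟨q₁, q₂, hq, hq₁, hq₂⟩ := hg₁.two_of_adj hc huS h₂ hwS huw (htA u hu)
  obtain ⟨s, hs, hspos⟩ := hg₁.exists_match hc hwS h₃ huS huw.symm hq₁
  obtain ⟨r, hr, hrpos⟩ := hg₁.exists_match hc huS h₂ hyS huy hspos
  have hSA : (A ∪ P) \ A = P := by
    rw [Finset.union_sdiff_left, Finset.sdiff_eq_self_of_disjoint hd.symm]
  -- `w` takes `q'` first and the rest of `P` is filled in by extension. As `w` is the only
  -- neighbour of `u` in `P`, the effect at `u` depends on `q'` alone.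
  have key : ∀ q', 0 < g₁ (w, q') → ∃ k, Crit G H k A ∧ (∀ r, k (y, r) = g₁ (y, r)) ∧
      ∀ s, k (u, s) = g₁ (u, s) - if H.Adj (u, s) (w, q') then 1 else 0 := by
    intro q' hq'
    obtain ⟨ψ, hψ, hψw⟩ := (good_singleton (H := H) (φ := fun _ => q') hq').exists_extend hc
      hg₁.valid (Finset.singleton_subset_iff.2 hwS) (by rwa [Finset.sdiff_singleton_eq_erase])
      (A := A) (by
        intro x hx
        simp only [Finset.mem_sdiff, Finset.mem_union, Finset.mem_singleton]
        exact ⟨Or.inl hx, fun h => hwA (h ▸ hx)⟩) hA.1.1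
    have hψw : ψ w = q' := hψw w (by simp)
    refine ⟨_, hg₁.residual hc Finset.subset_union_left hA.1 hψ, ?_, ?_⟩
    · intro r
      simp only [res]
      rw [hSA, cnt_eq_zero]
      · rfl
      · exact fun p hp hadj => hyP p hp (hc.base hadj)
    · intro s
      have h0 : cnt H ψ (P.erase w) u s = 0 := by
        apply cnt_eq_zero
        intro p hp hadj
        obtain ⟨hpw, hp⟩ := Finset.mem_erase.1 hp
        exact hpw ((huP p hp).1 (hc.base hadj))
      simp only [res]
      rw [hSA, cnt_erase hw, h0, zero_add, hψw]
  obtain ⟨k₁, hk₁, hk₁y, hk₁u⟩ := key q₁ hq₁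
  obtain ⟨k₂, hk₂, hk₂y, hk₂u⟩ := key q₂ hq₂
  have hty : Two g₁ y := htA y hy
  have ht₁ : ∃ a ∈ A, Two k₁ a := ⟨y, hy, hty.imp fun _ => by simp only [hk₁y]; exact id⟩
  have ht₂ : ∃ a ∈ A, Two k₂ a := ⟨y, hy, hty.imp fun _ => by simp only [hk₂y]; exact id⟩
  have hus₂ : k₂ (u, s) = g₁ (u, s) := by
    rw [hk₂u, if_neg, Nat.sub_zero]
    exact fun h' => hq (hc.eq_of_adj hs.symm h')
  have hus₁ : k₁ (u, s) = g₁ (u, s) - 1 := by rw [hk₁u, if_pos hs.symm]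
  -- `Uniform` needs a positive value at `(u, s)` even after the loss of one unit; matching back
  -- from `(y, r)` supplies it.
  obtain ⟨s', hs', hs'pos⟩ := hk₁.exists_match hc hy (hA.2 y hy) hu huy.symm
    (by rw [hk₁y]; exact hrpos : 0 < k₁ (y, r))
  obtain rfl := hc.eq_of_adj hr.symm hs'
  have e₁ := hU k₁ hk₁ ht₁ y hy u hu r s hr.symm (by rw [hk₁y]; exact hrpos) hs'pos
  have e₂ := hU k₂ hk₂ ht₂ y hy u hu r s hr.symm (by rw [hk₂y]; exact hrpos)
    (by rw [hus₂]; exact hspos)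
  rw [hk₁y, hus₁] at e₁
  rw [hk₂y, hus₂] at e₂
  omega

/-- The first `n + 1` terms of `p` form a walk in `T`. -/
def IsWalkIn (G : SimpleGraph V) (T : Finset V) (p : ℕ → V) (n : ℕ) : Prop :=
  (∀ i ≤ n, p i ∈ T) ∧ ∀ i < n, G.Adj (p i) (p (i + 1))

theorem IsWalkIn.take {p : ℕ → V} {n m : ℕ} (h : IsWalkIn G T p n) (hm : m ≤ n) :
    IsWalkIn G T p m :=
  ⟨fun i hi => h.1 i (hi.trans hm), fun i hi => h.2 i (hi.trans_le hm)⟩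

theorem IsWalkIn.drop {p : ℕ → V} {n m : ℕ} (h : IsWalkIn G T p (m + n)) :
    IsWalkIn G T (fun i => p (m + i)) n :=
  ⟨fun i hi => h.1 (m + i) (by omega), fun i hi => h.2 (m + i) (by omega)⟩

theorem IsWalkIn.conn {p : ℕ → V} {n : ℕ} (h : IsWalkIn G T p n) :
    Conn G ((Finset.range (n + 1)).image p) :=
  conn_image_range p n h.2

theorem IsWalkIn.image_subset {p : ℕ → V} {n : ℕ} (h : IsWalkIn G T p n) :
    (Finset.range (n + 1)).image p ⊆ T := by
  intro x hx
  obtain ⟨i, hi, rfl⟩ := Finset.mem_image.1 hx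
  exact h.1 i (by have := Finset.mem_range.1 hi; omega)

theorem isWalkIn_zero (hv : v ∈ T) : IsWalkIn G T (fun _ => v) 0 :=
  ⟨fun _ _ => hv, fun _ hi => absurd hi (by omega)⟩

theorem IsWalkIn.snoc {p : ℕ → V} {n : ℕ} (h : IsWalkIn G T p n) (hv : v ∈ T)
    (ha : G.Adj (p n) v) : IsWalkIn G T (fun i => if i ≤ n then p i else v) (n + 1) := by
  constructor
  · intro i _
    dsimp only
    split_ifs with h'
    · exact h.1 i h'
    · exact hv
  · intro i hi
    dsimp only
    rw [if_pos (by omega)]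
    split_ifs with h'
    · exact h.2 i (by omega)
    · obtain rfl : i = n := by omega
      exact ha

/-- In a block, a proper uniform block `A` whose critical residue has two colours is completely
joined to some further vertex. -/
theorem Crit.exists_join [Nonempty (Fin κ)] (hc : IsCover G H) (h : Crit G H g S)
    (hS : Block G S) (hA : Block G A) (hAS : A ⊆ S) (hne : A ≠ S) (hcard : 3 ≤ #A)
    (hU : Uniform G H A) (hφ : Good H g φ (S \ A)) {a : V} (ha : a ∈ A)
    (hta : Two (res H g φ (S \ A)) a) : ∃ w ∈ S, w ∉ A ∧ ∀ a ∈ A, G.Adj w a := by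
  by_contra! hcon
  -- An outside vertex seeing at least two but not all vertices of `A` would be an attachment by
  -- itself: some edge of `A` leads from a neighbour `u` to a non-neighbour `y`, and a second
  -- contact keeps the set connected without `u`.
  have huniq : ∀ w ∈ S \ A, ∀ c ∈ A, ∀ d ∈ A, G.Adj w c → G.Adj w d → c = d := by
    intro w hw c hcA d hdA hwc hwd
    by_contra hcd
    obtain ⟨hwS, hwA⟩ := Finset.mem_sdiff.1 hw
    obtain ⟨y₀, hy₀, hwy₀⟩ := hcon w hwS hwA
    obtain ⟨u, hu, y, hy, hy', huy⟩ := hA.1.2 {x ∈ A | G.Adj w x} (Finset.filter_subset _ _)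
      ⟨c, Finset.mem_filter.2 ⟨hcA, hwc⟩⟩
      (fun h => hwy₀ (Finset.mem_filter.1 (h ▸ hy₀)).2)
    obtain ⟨huA, hwu⟩ := Finset.mem_filter.1 hu
    refine h.no_attachment hc hA hAS hU hφ ha hta (P := {w}) (by simpa using hw)
      (Finset.mem_singleton_self w) huA hy huy ?_ ?_ ?_ ?_ ?_
    · intro p hp hyp
      obtain rfl := Finset.mem_singleton.1 hp
      exact hy' (Finset.mem_filter.2 ⟨hy, hyp.symm⟩)
    · intro p hp
      obtain rfl := Finset.mem_singleton.1 hp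
      simp [hwu.symm]
    · exact hA.1.union (conn_singleton w) ⟨u, huA, w, by simp, Or.inr hwu.symm⟩
    · rw [Finset.erase_union_distrib, Finset.erase_eq_of_notMem (s := {w})
        (by simpa using hwu.ne')]
      apply (hA.2 u huA).union (conn_singleton w)
      by_cases hcu : c = u
      · exact ⟨d, Finset.mem_erase.2 ⟨fun h => hcd (hcu.trans h.symm), hdA⟩, w, by simp,
          Or.inr hwd.symm⟩
      · exact ⟨c, Finset.mem_erase.2 ⟨hcu, hcA⟩, w, by simp, Or.inr hwc.symm⟩
    · rw [Finset.erase_union_distrib, Finset.erase_eq_of_notMem hwA]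
      simpa using hA.1
  -- Since `c` is not a cut vertex, an outside neighbour of `c` reaches `A` again while avoiding
  -- `c`.
  have hex : ∃ n, ∃ p, IsWalkIn G (S \ A) p n ∧ ∃ c ∈ A, ∃ d ∈ A, c ≠ d ∧ G.Adj (p 0) c ∧
      G.Adj (p n) d := by
    by_contra hno
    obtain ⟨c, hcA, w₀, hw₀, hw₀A, hcw₀⟩ := hS.1.2 A hAS hA.1.1 hne
    obtain ⟨a', ha', hca'⟩ := hA.1.exists_adj hcA (by
      rintro rfl
      simp at hcard)
    have := (hS.2 c (hAS hcA)).induction (u := w₀) (v := a')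
      (P := fun x => x ∉ A ∧ ∃ n p, IsWalkIn G (S \ A) p n ∧ p 0 = w₀ ∧ p n = x)
      (Finset.mem_erase.2 ⟨hcw₀.ne', hw₀⟩)
      ⟨hw₀A, 0, _, isWalkIn_zero (Finset.mem_sdiff.2 ⟨hw₀, hw₀A⟩), rfl, rfl⟩ (by
        rintro x hx y hy hxy ⟨hxA, n, p, hp, hp0, rfl⟩
        obtain ⟨hyc, hyS⟩ := Finset.mem_erase.1 hy
        by_cases hyA : y ∈ A
        · exact absurd ⟨n, p, hp, c, hcA, y, hyA, hyc.symm, hp0 ▸ hcw₀.symm, hxy⟩ hno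
        · exact ⟨hyA, n + 1, _, hp.snoc (Finset.mem_sdiff.2 ⟨hyS, hyA⟩) hxy, by simp [hp0],
            by simp⟩) (Finset.mem_erase.2 ⟨hca'.ne', hAS ha'⟩)
    exact this.1 ha'
  obtain ⟨p, hp, c, hcA, d, hdA, hcd, hpc, hpd⟩ := Nat.find_spec hex
  have hmin := fun m => Nat.find_min hex (m := m)
  set n := Nat.find hex
  -- On a shortest such walk, a contact with `A` elsewhere would allow cutting off one end.
  have honly : ∀ i ≤ n, ∀ e ∈ A, G.Adj (p i) e → (i = 0 ∧ e = c) ∨ (i = n ∧ e = d) := by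
    intro i hi e he hie
    have hleft : i < n → e = c := by
      intro hin
      by_contra hec
      exact hmin i hin ⟨p, hp.take hi, c, hcA, e, he, Ne.symm hec, hpc, hie⟩
    have hright : 0 < i → e = d := by
      intro hi0
      by_contra hed
      obtain ⟨m, hm⟩ := Nat.exists_eq_add_of_le hi
      rw [hm] at hp hpd
      exact hmin m (by omega) ⟨_, hp.drop, e, he, d, hdA, hed, hie, hpd⟩
    by_cases h0 : i = 0
    · by_cases hn : i = n
      · subst h0
        exact Or.inl ⟨rfl, huniq _ (hp.1 0 hi) e he c hcA hie hpc⟩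
      · exact Or.inl ⟨h0, hleft (by omega)⟩
    · have hd := hright (by omega)
      by_cases hn : i = n
      · exact Or.inr ⟨hn, hd⟩
      · exact absurd ((hleft (by omega)).symm.trans hd) hcd
  have hn : n ≠ 0 := by
    intro hn
    rw [hn] at hpd hp
    exact hcd (huniq _ (hp.1 0 le_rfl) c hcA d hdA hpc hpd)
  have hPA : ∀ x ∈ (Finset.range (n + 1)).image p, x ∉ A :=
    fun x hx => (Finset.mem_sdiff.1 (hp.image_subset hx)).2
  -- A neighbour of `c` in `A` other than `d`, hence with no neighbour on the walk. It exists
  -- because `A.erase d` is connected and has at least two vertices.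
  obtain ⟨y, hy, hcy⟩ := (hA.2 d hdA).exists_adj (Finset.mem_erase.2 ⟨hcd, hcA⟩) (by
    intro he
    have := Finset.card_erase_of_mem hdA
    rw [he, Finset.card_singleton] at this
    omega)
  obtain ⟨hyd, hyA⟩ := Finset.mem_erase.1 hy
  refine h.no_attachment hc hA hAS hU hφ ha hta (P := (Finset.range (n + 1)).image p)
    hp.image_subset (w := p 0) (Finset.mem_image_of_mem _ (by simp)) hcA hyA hcy ?_ ?_ ?_ ?_ ?_
  · intro x hx hyx
    obtain ⟨i, hi, rfl⟩ := Finset.mem_image.1 hx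
    rcases honly i (by have := Finset.mem_range.1 hi; omega) y hyA hyx.symm with h' | h'
    · exact hcy.ne h'.2.symm
    · exact hyd h'.2
  · intro x hx
    obtain ⟨i, hi, rfl⟩ := Finset.mem_image.1 hx
    constructor
    · intro hci
      rcases honly i (by have := Finset.mem_range.1 hi; omega) c hcA hci.symm with h' | h'
      · rw [h'.1]
      · exact absurd h'.2 hcd
    · intro h'
      rw [h']
      exact hpc.symm
  · exact hA.1.union hp.conn ⟨c, hcA, p 0, Finset.mem_image_of_mem _ (by simp), Or.inr hpc.symm⟩
  · rw [Finset.erase_union_distrib, Finset.erase_eq_of_notMem (fun h' => hPA c h' hcA)]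
    exact (hA.2 c hcA).union hp.conn ⟨d, Finset.mem_erase.2 ⟨hcd.symm, hdA⟩, p n,
      Finset.mem_image_of_mem _ (by simp), Or.inr hpd.symm⟩
  · obtain ⟨m, hm⟩ := Nat.exists_eq_succ_of_ne_zero hn
    have hp' : IsWalkIn G (S \ A) p (1 + m) := by
      rw [Nat.add_comm, ← Nat.succ_eq_add_one, ← hm]
      exact hp
    have hPe : ((Finset.range (n + 1)).image p).erase (p 0)
        = (Finset.range (m + 1)).image (fun i => p (1 + i)) := by
      ext x
      simp only [Finset.mem_erase, Finset.mem_image, Finset.mem_range]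
      constructor
      · rintro ⟨hx, i, hi, rfl⟩
        have hi0 : i ≠ 0 := fun h' => hx (by rw [h'])
        exact ⟨i - 1, by omega, by rw [show 1 + (i - 1) = i by omega]⟩
      · rintro ⟨i, hi, rfl⟩
        refine ⟨fun h' => ?_, 1 + i, by omega, rfl⟩
        rcases honly (1 + i) (by omega) c hcA (h' ▸ hpc) with h'' | h''
        · omega
        · exact hcd h''.2
    rw [Finset.erase_union_distrib, hPe, Finset.erase_eq_of_notMem
      (hPA _ (Finset.mem_image_of_mem _ (by simp)))]
    refine hA.1.union hp'.drop.conn ⟨d, hdA, p n, Finset.mem_image.2 ⟨m, by simp, ?_⟩,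
      Or.inr hpd.symm⟩
    show p (1 + m) = p n
    rw [hm, Nat.succ_eq_add_one, Nat.add_comm]

/-! ### Kernels over cliques. -/

theorem cnt_lt (h : A ⊆ S) (hu : u ∈ S) (hu' : u ∉ A) (ha : H.Adj (v, q) (u, φ u)) :
    cnt H φ A v q < cnt H φ S v q := by
  apply Finset.card_lt_card
  refine ⟨Finset.filter_subset_filter _ h, fun h' => hu' ?_⟩
  exact (Finset.mem_filter.1 (h' (Finset.mem_filter.2 ⟨hu, ha⟩))).1

theorem good_of_indep (hpos : ∀ v ∈ S, 0 < g (v, φ v))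
    (hind : ∀ v ∈ S, ∀ u ∈ S, ¬ H.Adj (v, φ v) (u, φ u)) : Good H g φ S := by
  intro B hB ⟨v, hv⟩
  refine ⟨v, hv, ?_⟩
  rw [cnt_eq_zero fun u hu => hind v (hB hv) u (hB hu)]
  exact hpos v (hB hv)

/-- The value of `(v, q)` is used up exactly by the choices over `S.erase v`; those over `S \ A`
omit `u`, so something is left. -/
theorem Crit.residual_pos (hc : IsCover G H) (h : Crit G H g S) (hA : A ⊆ S) (hv : v ∈ A)
    (hφ : Good H g φ (S.erase v)) (hu : u ∈ A) (ha : H.Adj (v, q) (u, φ u)) :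
    0 < res H g φ (S \ A) (v, q) := by
  have h1 := h.cnt_eq hc (hA hv) hφ q
  have h2 : cnt H φ (S \ A) v q < cnt H φ (S.erase v) v q := by
    apply cnt_lt (u := u)
    · intro x hx
      obtain ⟨hxS, hxA⟩ := Finset.mem_sdiff.1 hx
      exact Finset.mem_erase.2 ⟨fun h => hxA (h ▸ hv), hxS⟩
    · exact Finset.mem_erase.2 ⟨(hc.base ha).ne', hA hu⟩
    · simp [hu]
    · exact ha
  simp only [res]
  omega

theorem conn_of_isClique (hS : G.IsClique (S : Set V)) (hne : S.Nonempty) : Conn G S := by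
  refine ⟨hne, ?_⟩
  rintro B hB ⟨a, ha⟩ hBS
  obtain ⟨b, hb, hbB⟩ := Finset.exists_of_ssubset (hB.ssubset_of_ne hBS)
  exact ⟨a, ha, b, hb, hbB, hS (hB ha) hb fun h => hbB (h ▸ ha)⟩

theorem block_of_isClique (hS : G.IsClique (S : Set V)) (hcard : 2 ≤ #S) : Block G S := by
  refine ⟨conn_of_isClique hS (Finset.card_pos.1 (by omega)), fun v hv => ?_⟩
  apply conn_of_isClique (hS.subset (by simp))
  rw [← Finset.card_pos, Finset.card_erase_of_mem hv]
  omega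

theorem dg_of_isClique (hS : G.IsClique (S : Set V)) (hv : v ∈ S) : dg G S v = #S - 1 := by
  rw [← Finset.card_erase_of_mem hv]
  unfold dg
  congr 1
  ext u
  simp only [Finset.mem_filter, Finset.mem_erase]
  exact ⟨fun h => ⟨h.2.ne', h.1⟩, fun h => ⟨h.2, hS hv h.2 h.1.symm⟩⟩

theorem isClique_triple {x y z : V} (hxy : G.Adj x y) (hyz : G.Adj y z) (hxz : G.Adj x z) :
    G.IsClique (({x, y, z} : Finset V) : Set V) := by
  simp [SimpleGraph.isClique_insert, hxy, hyz, hxz]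

/-- Over a triangle with two colours the kernel is not twisted. -/
theorem Crit.triangle_trans [Nonempty (Fin κ)] (hc : IsCover G H) {x y z : V}
    (h : Crit G H g {x, y, z}) (hxy : G.Adj x y) (hyz : G.Adj y z) (hxz : G.Adj x z)
    {t : V} (ht : t ∈ ({x, y, z} : Finset V)) (htwo : Two g t) {a b c : Fin κ}
    (hab : H.Adj (x, a) (y, b)) (hbc : H.Adj (y, b) (z, c)) (ha : 0 < g (x, a))
    (hcpos : 0 < g (z, c)) : H.Adj (x, a) (z, c) := by
  by_contra hn
  have hb : Block G ({x, y, z} : Finset V) := by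
    apply block_of_isClique (isClique_triple hxy hyz hxz)
    rw [Finset.card_eq_three.2 ⟨x, y, z, hxy.ne, hxz.ne, hyz.ne, rfl⟩]
    omega
  have hy : Two g y := h.two hc hb ht (by simp) htwo
  -- A second colour of `y` is matched neither to `(x, a)` nor to `(z, c)`, so together with these
  -- it forms an independent transversal.
  obtain ⟨b', hb', hb'pos⟩ : ∃ b', b' ≠ b ∧ 0 < g (y, b') := by
    obtain ⟨q₁, q₂, hne, h₁, h₂⟩ := hy
    by_cases hq : q₁ = b
    · exact ⟨q₂, fun h' => hne (hq.trans h'.symm), h₂⟩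
    · exact ⟨q₁, hq, h₁⟩
  have n1 : ¬ H.Adj (x, a) (y, b') := fun h' => hb' (hc.eq_of_adj h' hab)
  have n2 : ¬ H.Adj (y, b') (z, c) := fun h' => hb' (hc.eq_of_adj' h' hbc)
  have n1' : ¬ H.Adj (y, b') (x, a) := fun h' => n1 h'.symm
  have n2' : ¬ H.Adj (z, c) (y, b') := fun h' => n2 h'.symm
  have n3' : ¬ H.Adj (z, c) (x, a) := fun h' => hn h'.symm
  apply h.bad
  refine ⟨fun t => if t = x then a else if t = y then b' else c, good_of_indep ?_ ?_⟩
  · intro v hv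
    simp only [Finset.mem_insert, Finset.mem_singleton] at hv
    rcases hv with rfl | rfl | rfl
    · simpa using ha
    · simpa [hxy.ne'] using hb'pos
    · simpa [hxz.ne', hyz.ne'] using hcpos
  · intro v hv u hu
    simp only [Finset.mem_insert, Finset.mem_singleton] at hv hu
    rcases hv with hv | hv | hv <;> rcases hu with hu | hu | hu <;>
      simp [hv, hu, hxy.ne', hxz.ne', hyz.ne', n1, n2, hn, n1', n2', n3']

/-- If `y` takes `b` and `z` takes some `e ≠ c'`, then `y` blocks `a` at `x` and `z` blocks a
different colour there. The residue on the triangle thus has two colours at `x`, and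
`Crit.triangle_trans` gives `(x, a)` and `(z, c)` adjacent, against `c ≠ c'`. -/
theorem Crit.clique_twist [Nonempty (Fin κ)] (hc : IsCover G H) (h : Crit G H g S)
    (hS : G.IsClique (S : Set V)) {x y z : V} (hx : x ∈ S) (hy : y ∈ S) (hz : z ∈ S)
    (hxy : x ≠ y) (hyz : y ≠ z) (hxz : x ≠ z) {a b c c' e : Fin κ}
    (hab : H.Adj (x, a) (y, b)) (hbc : H.Adj (y, b) (z, c)) (hac : H.Adj (x, a) (z, c'))
    (hb : 0 < g (y, b)) (hne : c ≠ c')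
    (he : (if H.Adj (z, e) (y, b) then 1 else 0) < g (z, e)) : e = c' := by
  by_contra hec
  have hg : Good H g (Function.update (fun _ => b) z e) (insert z {y}) := by
    apply (good_singleton (H := H) (φ := fun _ => b) hb).insert_last
    · simpa using hyz.symm
    · rwa [cnt_singleton]
  have hsub : insert z {y} ⊆ S := by
    simp [Finset.insert_subset_iff, hy, hz]
  have hxs : x ∈ S \ insert z {y} := by simp [hx, hxy, hxz]
  obtain ⟨T, hT, hTe⟩ := hg.exists_extend hc h.valid hsub
    (conn_of_isClique (hS.subset (by simp)) ⟨x, hxs⟩) (A := {x}) (by simpa using hxs) (by simp)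
  have hTz : T z = e := by
    rw [hTe z (by simp), Function.update_self]
  have hTy : T y = b := by
    rw [hTe y (by simp), Function.update_of_ne hyz]
  rw [Finset.sdiff_singleton_eq_erase] at hT
  have hD : ({x, y, z} : Finset V) ⊆ S := by simp [Finset.insert_subset_iff, hx, hy, hz]
  have hDc : G.IsClique (({x, y, z} : Finset V) : Set V) := hS.subset (by exact_mod_cast hD)
  have hk := h.residual hc hD (conn_of_isClique hDc (by simp)) (hT.mono (by
    intro t ht
    simp only [Finset.mem_sdiff, Finset.mem_insert, not_or, Finset.mem_erase] at ht ⊢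
    exact ⟨ht.2.1, ht.1⟩))
  have p1 := h.residual_pos hc hD (by simp) hT (u := y) (q := a) (by simp) (by rwa [hTy])
  obtain ⟨a', ha'⟩ := h.exists_adj hc hx hT hz (hS hx hz hxz)
  have p2 := h.residual_pos hc hD (by simp) hT (u := z) (q := a') (by simp) ha'
  have haa' : a ≠ a' := by
    rintro rfl
    rw [hTz] at ha'
    exact hec (hc.eq_of_adj ha' hac)
  have hDb : Block G ({x, y, z} : Finset V) := by
    apply block_of_isClique hDc
    rw [Finset.card_eq_three.2 ⟨x, y, z, hxy, hxz, hyz, rfl⟩]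
    omega
  obtain ⟨b₁, hb₁, hb₁pos⟩ := hk.exists_match hc (by simp) (hDb.2 x (by simp)) (u := y)
    (by simp) (hS hx hy hxy) p1
  obtain rfl := hc.eq_of_adj hab hb₁
  obtain ⟨c₁, hc₁, hc₁pos⟩ := hk.exists_match hc (by simp) (hDb.2 y (by simp)) (u := z)
    (by simp) (hS hy hz hyz) hb₁pos
  obtain rfl := hc.eq_of_adj hbc hc₁
  have := hk.triangle_trans hc (hS hx hy hxy) (hS hy hz hyz) (hS hx hz hxz) (t := x) (by simp)
    ⟨a, a', haa', p1, p2⟩ hab hbc p1 hc₁pos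
  exact hne (hc.eq_of_adj this hac)

/-- Over a clique with two colours the adjacency of the kernel is transitive across fibres. -/
theorem Crit.clique_trans [Nonempty (Fin κ)] (hc : IsCover G H) (h : Crit G H g S)
    (hS : G.IsClique (S : Set V)) {t : V} (ht : t ∈ S) (htwo : Two g t)
    {x y z : V} (hx : x ∈ S) (hy : y ∈ S) (hz : z ∈ S) (hxz : x ≠ z) {a b c : Fin κ}
    (hab : H.Adj (x, a) (y, b)) (hbc : H.Adj (y, b) (z, c)) (ha : 0 < g (x, a))
    (hb : 0 < g (y, b)) (hcpos : 0 < g (z, c)) : H.Adj (x, a) (z, c) := by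
  have hxy : x ≠ y := (hc.base hab).ne
  have hyz : y ≠ z := (hc.base hbc).ne
  by_contra hn
  have hbl : Block G S := block_of_isClique hS (Finset.one_lt_card.2 ⟨x, hx, y, hy, hxy⟩)
  have hm : ∀ {u v : V} {q : Fin κ}, v ∈ S → u ∈ S → v ≠ u → 0 < g (v, q) →
      ∃ q', H.Adj (v, q) (u, q') ∧ 0 < g (u, q') := fun hv hu hne hq =>
    h.exists_match hc hv (hbl.2 _ hv) hu (hS hv hu hne) hq
  obtain ⟨c', hac, hc'pos⟩ := hm hx hz hxz ha
  have hcc : c ≠ c' := fun h' => hn (h' ▸ hac)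
  obtain ⟨a₂, hca₂, ha₂⟩ := hm hz hx hxz.symm hcpos
  have haa : a₂ ≠ a := fun h' => hn (h' ▸ hca₂.symm)
  obtain ⟨b₂, hab₂, hb₂⟩ := hm hx hy hxy ha₂
  have hbb : b₂ ≠ b := by
    rintro rfl
    exact haa (hc.eq_of_adj' hab₂ hab)
  obtain ⟨c₂, hbc₂, hc₂⟩ := hm hy hz hyz hb₂
  have hcc₂ : c₂ ≠ c := by
    rintro rfl
    exact hbb (hc.eq_of_adj' hbc₂ hbc)
  -- After `b` at `y` only `c'` is available at `z`; hence `z` has no further positive colours and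
  -- `c` has value 1. The path continued from `(z, c)` through `a₂` and `b₂` ends at `c'` and gives
  -- value 1 there too. Total value 2 means that the clique is a triangle.
  have key₁ : ∀ e, (if H.Adj (z, e) (y, b) then 1 else 0) < g (z, e) → e = c' :=
    fun e he => h.clique_twist hc hS hx hy hz hxy hyz hxz hab hbc hac hb hcc he
  have hzero : ∀ e, e ≠ c → e ≠ c' → g (z, e) = 0 := by
    intro e hec hec'
    by_contra hpos
    apply hec'
    apply key₁
    rw [if_neg fun h' => hec (hc.eq_of_adj h'.symm hbc)]
    omega
  have hc₂c' : c₂ = c' := by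
    by_contra h'
    exact hc₂.ne' (hzero c₂ hcc₂ h')
  subst hc₂c'
  have key₂ : ∀ e, (if H.Adj (z, e) (y, b₂) then 1 else 0) < g (z, e) → e = c :=
    fun e he => h.clique_twist hc hS hx hy hz hxy hyz hxz hab₂ hbc₂ hca₂.symm hb₂ hcc.symm he
  have h1 : g (z, c) = 1 := by
    by_contra h'
    apply hcc
    apply key₁
    rw [if_pos hbc.symm]
    omega
  have h2 : g (z, c₂) = 1 := by
    by_contra h'
    apply hcc.symm
    apply key₂
    rw [if_pos hbc₂.symm]
    omega
  have hsum : ∑ q, g (z, q) = 2 := by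
    rw [← Finset.sum_subset (Finset.subset_univ {c, c₂}), Finset.sum_pair hcc, h1, h2]
    intro e _ he
    simp only [Finset.mem_insert, Finset.mem_singleton, not_or] at he
    exact hzero e he.1 he.2
  rw [h.sum_eq hc hz, dg_of_isClique hS hz] at hsum
  have hD : ({x, y, z} : Finset V) = S := by
    apply Finset.eq_of_subset_of_card_le
    · simp [Finset.insert_subset_iff, hx, hy, hz]
    · rw [Finset.card_eq_three.2 ⟨x, y, z, hxy, hxz, hyz, rfl⟩]
      omega
  subst hD
  exact hn (h.triangle_trans hc (hS hx hy hxy) (hS hy hz hyz) (hS hx hz hxz) ht htwo hab hbc ha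
    hcpos)

/-- A transversal missing `x` becomes one missing `y` when `y` is uncoloured and `x` takes the
colour `a₀` that `y` blocked. By `Crit.clique_trans`, `(x, a)` and `(y, b)` see the same chosen
vertices over the common rest, and the two remaining terms agree by the matching. Exact blocking
turns these counts into the values. -/
theorem uniform_of_isClique [Nonempty (Fin κ)] (hc : IsCover G H)
    (hS : G.IsClique (S : Set V)) : Uniform G H S := by
  rintro g h ⟨t, ht, htwo⟩ x hx y hy a b hab ha hb
  have hxy : x ≠ y := (hc.base hab).ne
  obtain ⟨T, hT⟩ := h.conn.colorable_sdiff hc h.valid (A := {x}) (by simpa using hx) (by simp)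
  rw [Finset.sdiff_singleton_eq_erase] at hT
  obtain ⟨a₀, ha₀⟩ := h.exists_adj hc hx hT hy (hS hx hy hxy)
  set R := (S.erase x).erase y with hR
  have hyx : y ∈ S.erase x := Finset.mem_erase.2 ⟨hxy.symm, hy⟩
  have hxR : x ∉ R := by simp [hR]
  have hT' : Good H g (Function.update T x a₀) (insert x R) := by
    apply (hT.mono (Finset.erase_subset _ _)).insert_last hxR
    rw [← h.cnt_eq hc hx hT a₀]
    exact cnt_lt (Finset.erase_subset _ _) hyx (by simp) ha₀
  have hSy : insert x R = S.erase y := by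
    rw [hR, Finset.erase_right_comm, Finset.insert_erase (Finset.mem_erase.2 ⟨hxy, hx⟩)]
  rw [hSy] at hT'
  have hRu : ∀ u ∈ R, Function.update T x a₀ u = T u := by
    intro u hu
    rw [Function.update_of_ne]
    rintro rfl
    exact hxR hu
  have e₁ := h.cnt_eq hc hx hT a
  have e₂ := h.cnt_eq hc hy hT' b
  rw [cnt_erase hyx] at e₁
  rw [← hSy, cnt_erase (Finset.mem_insert_self x R), Finset.erase_insert hxR,
    cnt_congr hRu, Function.update_self] at e₂
  have e₃ : cnt H T R x a = cnt H T R y b := by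
    unfold cnt
    congr 1
    apply Finset.filter_congr
    intro z hz
    have hzx : z ≠ x := fun h' => hxR (h' ▸ hz)
    have hzy : z ≠ y := (Finset.mem_erase.1 hz).1
    have hzS : z ∈ S.erase x := (Finset.mem_erase.1 hz).2
    have hpos := hT.pos hzS
    exact ⟨fun h' => h.clique_trans hc hS ht htwo hy hx (Finset.mem_of_mem_erase hzS) hzy.symm
      hab.symm h' hb ha hpos, fun h' => h.clique_trans hc hS ht htwo hx hy
      (Finset.mem_of_mem_erase hzS) hzx.symm hab h' ha hb hpos⟩
  have e₄ : H.Adj (x, a) (y, T y) ↔ H.Adj (y, b) (x, a₀) := by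
    constructor
    · intro h'
      rw [← hc.eq_of_adj' h' ha₀]
      exact hab.symm
    · intro h'
      rw [hc.eq_of_adj hab.symm h']
      exact ha₀
  rw [← e₁, ← e₂, e₃]
  simp only [e₄]

/-! ### Induced cycles. -/

/-- The first `n` terms of `c` are the consecutive vertices of an induced cycle. -/
structure IsCyc (G : SimpleGraph V) (c : ℕ → V) (n : ℕ) : Prop where
  three_le : 3 ≤ n
  inj : ∀ i < n, ∀ j < n, c i = c j → i = j
  adj : ∀ i < n, ∀ j < n, G.Adj (c i) (c j) ↔
    i + 1 = j ∨ j + 1 = i ∨ (i = 0 ∧ j + 1 = n) ∨ (j = 0 ∧ i + 1 = n)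

/-- The vertex set of a cycle. -/
noncomputable def cyc (c : ℕ → V) (n : ℕ) : Finset V := (Finset.range n).image c

variable {c : ℕ → V} {n : ℕ}

theorem mem_cyc {i : ℕ} (hi : i < n) : c i ∈ cyc c n :=
  Finset.mem_image_of_mem _ (Finset.mem_range.2 hi)

theorem exists_of_mem_cyc (h : v ∈ cyc c n) : ∃ i < n, c i = v := by
  obtain ⟨i, hi, rfl⟩ := Finset.mem_image.1 h
  exact ⟨i, Finset.mem_range.1 hi, rfl⟩

theorem IsCyc.conn (h : IsCyc G c n) : Conn G (cyc c n) := by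
  have h3 := h.three_le
  obtain ⟨m, rfl⟩ : ∃ m, n = m + 1 := ⟨n - 1, by omega⟩
  exact conn_image_range c m fun i hi => (h.adj i (by omega) (i + 1) (by omega)).2 (by omega)

theorem IsCyc.card (h : IsCyc G c n) : #(cyc c n) = n := by
  unfold cyc
  rw [Finset.card_image_of_injOn, Finset.card_range]
  intro i hi j hj hij
  exact h.inj i (by simpa using hi) j (by simpa using hj) hij

/-- Deleting `c i` leaves two arcs, one possibly empty; if both are nonempty, the edge between `c 0`
and `c (n - 1)` joins them. -/
theorem IsCyc.block (h : IsCyc G c n) : Block G (cyc c n) := by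
  have h3 := h.three_le
  refine ⟨h.conn, fun v hv => ?_⟩
  obtain ⟨i, hi, rfl⟩ := exists_of_mem_cyc hv
  have hleft : 0 < i → Conn G ((Finset.range i).image c) := by
    intro hi0
    obtain ⟨m, rfl⟩ : ∃ m, i = m + 1 := ⟨i - 1, by omega⟩
    exact conn_image_range c m fun j hj => (h.adj j (by omega) (j + 1) (by omega)).2 (by omega)
  have hright : i + 1 < n →
      Conn G ((Finset.range (n - 1 - i)).image fun j => c (i + 1 + j)) := by
    intro hin
    obtain ⟨m, hm⟩ : ∃ m, n - 1 - i = m + 1 := ⟨n - 1 - i - 1, by omega⟩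
    rw [hm]
    exact conn_image_range _ m fun j hj =>
      (h.adj _ (by omega) _ (by omega)).2 (by omega)
  have heq : (cyc c n).erase (c i) =
      (Finset.range i).image c ∪ (Finset.range (n - 1 - i)).image fun j => c (i + 1 + j) := by
    ext x
    simp only [Finset.mem_erase, Finset.mem_union, Finset.mem_image, Finset.mem_range, cyc]
    constructor
    · rintro ⟨hx, j, hj, rfl⟩
      rcases lt_trichotomy j i with hji | rfl | hji
      · exact Or.inl ⟨j, hji, rfl⟩
      · exact absurd rfl hx
      · exact Or.inr ⟨j - (i + 1), by omega, by rw [show i + 1 + (j - (i + 1)) = j by omega]⟩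
    · rintro (⟨j, hj, rfl⟩ | ⟨j, hj, rfl⟩)
      · refine ⟨fun h' => ?_, j, by omega, rfl⟩
        have := h.inj _ (by omega) _ (by omega) h'
        omega
      · refine ⟨fun h' => ?_, i + 1 + j, by omega, rfl⟩
        have := h.inj _ (by omega) _ (by omega) h'
        omega
  rw [heq]
  by_cases h0 : i = 0
  · subst h0
    simpa using hright (by omega)
  · by_cases hl : i + 1 = n
    · have : n - 1 - i = 0 := by omega
      rw [this]
      simpa using hleft (by omega)
    · refine (hleft (by omega)).union (hright (by omega)) ⟨c 0, ?_, c (n - 1), ?_, Or.inr ?_⟩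
      · exact Finset.mem_image_of_mem _ (Finset.mem_range.2 (by omega))
      · exact Finset.mem_image.2 ⟨n - 1 - i - 1, Finset.mem_range.2 (by omega), by
          rw [show i + 1 + (n - 1 - i - 1) = n - 1 by omega]⟩
      · exact (h.adj _ (by omega) _ (by omega)).2 (by omega)

theorem IsCyc.dg_le (h : IsCyc G c n) (hv : v ∈ cyc c n) : dg G (cyc c n) v ≤ 2 := by
  obtain ⟨i, hi, rfl⟩ := exists_of_mem_cyc hv
  have hsub : {u ∈ cyc c n | G.Adj (c i) u} ⊆
      {c (if i + 1 = n then 0 else i + 1), c (if i = 0 then n - 1 else i - 1)} := by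
    intro u hu
    obtain ⟨hu, hiu⟩ := Finset.mem_filter.1 hu
    obtain ⟨j, hj, rfl⟩ := exists_of_mem_cyc hu
    rw [Finset.mem_insert, Finset.mem_singleton]
    rcases (h.adj i hi j hj).1 hiu with h' | h' | h' | h'
    · left
      rw [if_neg (by omega), h']
    · right
      rw [if_neg (by omega)]
      congr 1
      omega
    · right
      rw [if_pos h'.1]
      congr 1
      omega
    · left
      rw [if_pos h'.2, h'.1]
  exact (Finset.card_le_card hsub).trans Finset.card_le_two

theorem eq_one_of_two (h : ∑ q, g (v, q) ≤ 2) (ht : Two g v) (hq : 0 < g (v, q)) :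
    g (v, q) = 1 := by
  obtain ⟨q₁, q₂, hne, h₁, h₂⟩ := ht
  obtain ⟨r, hr, hrpos⟩ : ∃ r, r ≠ q ∧ 0 < g (v, r) := by
    by_cases h' : q₁ = q
    · exact ⟨q₂, fun h'' => hne (h'.trans h''.symm), h₂⟩
    · exact ⟨q₁, h', h₁⟩
  have := Finset.sum_le_sum_of_subset (f := fun q => g (v, q)) (Finset.subset_univ {r, q})
  rw [Finset.sum_pair hr] at this
  omega

/-- Tightness bounds the total at a vertex by its degree 2, and two colours are positive. -/
theorem IsCyc.eq_one [Nonempty (Fin κ)] (hc : IsCover G H) (hcyc : IsCyc G c n)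
    (h : Crit G H g (cyc c n)) (ht : ∃ a ∈ cyc c n, Two g a) (hv : v ∈ cyc c n)
    (hq : 0 < g (v, q)) : g (v, q) = 1 := by
  obtain ⟨a, ha, hta⟩ := ht
  apply eq_one_of_two _ (h.two hc hcyc.block ha hv hta) hq
  rw [h.sum_eq hc hv]
  exact hcyc.dg_le hv

theorem IsCyc.uniform [Nonempty (Fin κ)] (hc : IsCover G H) (hcyc : IsCyc G c n) :
    Uniform G H (cyc c n) := by
  intro g h ht x hx y hy a b _ ha hb
  rw [hcyc.eq_one hc h ht hx ha, hcyc.eq_one hc h ht hy hb]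

/-! ### Critical blocks with two colours are complete or cycles. -/

/-- A block containing a triangle over which the critical residue has two colours is complete. -/
theorem Crit.isClique_of_triangle [Nonempty (Fin κ)] (hc : IsCover G H) (h : Crit G H g S)
    (hS : Block G S) {x y z : V} (hD : {x, y, z} ⊆ S) (hxy : G.Adj x y) (hyz : G.Adj y z)
    (hxz : G.Adj x z) (hφ : Good H g φ (S \ {x, y, z})) (ht : Two (res H g φ (S \ {x, y, z})) x) :
    G.IsClique (S : Set V) := by
  -- A largest clique containing the triangle: a vertex joined to all of it would enlarge it.
  obtain ⟨K, hK, hmax⟩ := Finset.exists_max_image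
    (S.powerset.filter fun K : Finset V => {x, y, z} ⊆ K ∧ G.IsClique (K : Set V)) (fun K => #K)
    ⟨{x, y, z}, by
      simp only [Finset.mem_filter, Finset.mem_powerset]
      exact ⟨hD, subset_rfl, isClique_triple hxy hyz hxz⟩⟩
  simp only [Finset.mem_filter, Finset.mem_powerset] at hK hmax
  obtain ⟨hKS, hDK, hKc⟩ := hK
  by_cases hne : K = S
  · exact hne ▸ hKc
  have hcard : 3 ≤ #K := by
    rw [← Finset.card_eq_three.2 ⟨x, y, z, hxy.ne, hxz.ne, hyz.ne, rfl⟩]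
    exact Finset.card_le_card hDK
  have hsub : S \ K ⊆ S \ {x, y, z} := Finset.sdiff_subset_sdiff subset_rfl hDK
  obtain ⟨w, hwS, hwK, hw⟩ := h.exists_join hc hS (block_of_isClique hKc (by omega)) hKS hne hcard
    (uniform_of_isClique hc hKc) (hφ.mono hsub) (hDK (by simp : x ∈ ({x, y, z} : Finset V)))
    (ht.mono fun p => by
      have := cnt_mono (H := H) (φ := φ) hsub p.1 p.2
      simp only [res]
      omega)
  have hle := hmax (insert w K) ⟨Finset.insert_subset hwS hKS,
    hDK.trans (Finset.subset_insert _ _), by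
      rw [Finset.coe_insert, SimpleGraph.isClique_insert]
      exact ⟨hKc, fun b hb _ => hw b hb⟩⟩
  rw [Finset.card_insert_of_notMem hwK] at hle
  omega

/-- A block containing a long induced cycle over which the critical residue has two colours is
this cycle. -/
theorem Crit.eq_cyc [Nonempty (Fin κ)] (hc : IsCover G H) (h : Crit G H g S)
    (hS : Block G S) (hcyc : IsCyc G c n) (hn : 4 ≤ n) (hsub : cyc c n ⊆ S)
    (hφ : Good H g φ (S \ cyc c n)) {a : V} (ha : a ∈ cyc c n)
    (ht : Two (res H g φ (S \ cyc c n)) a) : cyc c n = S := by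
  by_contra hne
  obtain ⟨w, hwS, hwC, hw⟩ := h.exists_join hc hS hcyc.block hsub hne
    (by rw [hcyc.card]; omega) (hcyc.uniform hc) hφ ha ht
  set C := cyc c n with hCdef
  have h02 : ¬ G.Adj (c 0) (c 2) := by
    rw [hcyc.adj 0 (by omega) 2 (by omega)]
    omega
  have hS₁ : insert w C ⊆ S := Finset.insert_subset hwS hsub
  have hsub₁ : S \ insert w C ⊆ S \ C :=
    Finset.sdiff_subset_sdiff subset_rfl (Finset.subset_insert _ _)
  -- The argument moves to the wheel with hub `w` and rim `C`.
  have hb : Block G (insert w C) := by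
    have hins : ∀ B ⊆ C, Conn G B → Conn G (insert w B) := by
      intro B hB hBc
      obtain ⟨b, hbB⟩ := hBc.1
      exact (conn_singleton w).union hBc ⟨w, by simp, b, hbB, Or.inr (hw b (hB hbB))⟩
    refine ⟨hins C subset_rfl hcyc.conn, fun v hv => ?_⟩
    rcases Finset.mem_insert.1 hv with rfl | hv
    · rw [Finset.erase_insert hwC]
      exact hcyc.conn
    · have hwv : w ≠ v := by
        rintro rfl
        exact hwC hv
      rw [Finset.erase_insert_of_ne hwv]
      exact hins _ (Finset.erase_subset _ _) (hcyc.block.2 v hv)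
  have hk := h.residual hc hS₁ hb.1 (hφ.mono hsub₁)
  set k := res H g φ (S \ insert w C)
  have hta : Two k a := ht.mono fun p => by
    have := cnt_mono (H := H) (φ := φ) hsub₁ p.1 p.2
    simp only [k, res]
    omega
  have hwm : w ∈ insert w C := Finset.mem_insert_self w C
  obtain ⟨q₁, q₂, hq, hq₁, hq₂⟩ := hk.two hc hb (Finset.mem_insert_of_mem ha) hwm hta
  obtain ⟨T, hT⟩ := hk.conn.colorable_sdiff hc hk.valid (A := {w}) (by simp) (by simp)
  rw [Finset.sdiff_singleton_eq_erase] at hT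
  rw [← hk.cnt_eq hc hwm hT, Finset.erase_insert hwC] at hq₁ hq₂
  obtain ⟨u₁, hu₁, hadj₁⟩ := exists_of_cnt_pos hq₁
  obtain ⟨u₂, hu₂, hadj₂⟩ := exists_of_cnt_pos hq₂
  -- Two colours are blocked at the hub, so along some rim edge the blocked colour changes. This
  -- edge and the hub form a triangle with a two-coloured residue, which makes the wheel complete
  -- and contradicts `h02`.
  obtain ⟨b, hbC, d, hdC, hbd, hwb, hwd⟩ : ∃ b ∈ C, ∃ d ∈ C, G.Adj b d ∧
      H.Adj (w, q₁) (b, T b) ∧ ¬ H.Adj (w, q₁) (d, T d) := by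
    by_contra! hcon
    have := hcyc.conn.induction (P := fun x => H.Adj (w, q₁) (x, T x)) hu₁ hadj₁
      (fun b hb d hd hbd hwb => hcon b hb d hd hbd hwb) hu₂
    exact hq (hc.eq_of_adj' this hadj₂)
  obtain ⟨q₃, hq₃⟩ := hk.exists_adj hc hwm hT (Finset.mem_insert_of_mem hdC) (hw d hdC)
  have hD : {w, b, d} ⊆ insert w C := by
    simp [Finset.insert_subset_iff, hbC, hdC]
  have hclique := hk.isClique_of_triangle hc hb hD (hw b hbC) hbd (hw d hdC) (hT.mono (by
      intro t ht
      simp only [Finset.mem_sdiff, Finset.mem_insert, not_or, Finset.mem_erase] at ht ⊢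
      tauto))
    ⟨q₁, q₃, by rintro rfl; exact hwd hq₃,
      hk.residual_pos hc hD (by simp) hT (by simp) hwb,
      hk.residual_pos hc hD (by simp) hT (by simp) hq₃⟩
  apply h02
  apply hclique
  · exact_mod_cast Finset.mem_insert_of_mem (mem_cyc (by omega))
  · exact_mod_cast Finset.mem_insert_of_mem (mem_cyc (by omega))
  · intro h'
    have := hcyc.inj 0 (by omega) 2 (by omega) h'
    omega

theorem IsWalkIn.shortcut {p : ℕ → V} {m i j : ℕ} (h : IsWalkIn G T p m) (hij : i + 1 < j)
    (hj : j ≤ m) (ha : G.Adj (p i) (p j)) :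
    IsWalkIn G T (fun t => if t ≤ i then p t else p (t + (j - i - 1))) (m - (j - i - 1)) := by
  constructor
  · intro t ht
    dsimp only
    split_ifs
    · exact h.1 t (by omega)
    · exact h.1 _ (by omega)
  · intro t ht
    dsimp only
    by_cases h1 : t + 1 ≤ i
    · rw [if_pos (by omega), if_pos h1]
      exact h.2 t (by omega)
    · by_cases h2 : t ≤ i
      · obtain rfl : t = i := by omega
        rw [if_pos h2, if_neg h1, show t + 1 + (j - t - 1) = j by omega]
        exact ha
      · rw [if_neg h2, if_neg h1, show t + 1 + (j - i - 1) = t + (j - i - 1) + 1 by omega]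
        exact h.2 _ (by omega)

/-- A critical block with two colours contains an induced cycle over which some residue has two
colours. -/
theorem Crit.exists_cyc [Nonempty (Fin κ)] (hc : IsCover G H) (h : Crit G H g S)
    (hS : Block G S) (hv : v ∈ S) (ht : Two g v) : ∃ c n φ, IsCyc G c n ∧ cyc c n ⊆ S ∧
      Good H g φ (S \ cyc c n) ∧ c 0 = v ∧ Two (res H g φ (S \ cyc c n)) v := by
  obtain ⟨T, hT⟩ := h.conn.colorable_sdiff hc h.valid (A := {v}) (by simpa using hv) (by simp)
  rw [Finset.sdiff_singleton_eq_erase] at hT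
  -- Walks avoiding `v` whose ends block different colours of `v`. A shortest one, closed up by `v`,
  -- is the cycle sought.
  have hex : ∃ m p, IsWalkIn G (S.erase v) p m ∧ ∃ q₁ q₂, q₁ ≠ q₂ ∧
      H.Adj (v, q₁) (p 0, T (p 0)) ∧ H.Adj (v, q₂) (p m, T (p m)) := by
    obtain ⟨q₁, q₂, hq, hq₁, hq₂⟩ := ht
    rw [← h.cnt_eq hc hv hT] at hq₁ hq₂
    obtain ⟨u₁, hu₁, hadj₁⟩ := exists_of_cnt_pos hq₁
    obtain ⟨u₂, hu₂, hadj₂⟩ := exists_of_cnt_pos hq₂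
    obtain ⟨m, p, hp, rfl, rfl⟩ := (hS.2 v hv).induction
      (P := fun x => ∃ m p, IsWalkIn G (S.erase v) p m ∧ p 0 = u₁ ∧ p m = x) hu₁
      ⟨0, _, isWalkIn_zero hu₁, rfl, rfl⟩ (by
        rintro x hx y hy hxy ⟨m, p, hp, hp0, rfl⟩
        exact ⟨m + 1, _, hp.snoc hy hxy, by simp [hp0], by simp⟩) hu₂
    exact ⟨m, p, hp, q₁, q₂, hq, hadj₁, hadj₂⟩
  obtain ⟨p, hp, q₁, q₂, hq, hadj₁, hadj₂⟩ := Nat.find_spec hex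
  have hmin := fun m => Nat.find_min hex (m := m)
  set m := Nat.find hex
  have hm : m ≠ 0 := by
    intro h0
    rw [h0] at hadj₂
    exact hq (hc.eq_of_adj' hadj₁ hadj₂)
  have hchord : ∀ i j, i < j → j ≤ m → G.Adj (p i) (p j) → i + 1 = j := by
    intro i j hij hj ha
    by_contra hne
    refine hmin (m - (j - i - 1)) (by omega) ⟨_, hp.shortcut (by omega) hj ha, q₁, q₂, hq, ?_, ?_⟩
    · simpa using hadj₁
    · rw [if_neg (by omega), show m - (j - i - 1) + (j - i - 1) = m by omega]
      exact hadj₂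
  have hinj : ∀ i j, i < j → j ≤ m → p i ≠ p j := by
    intro i j hij hj hpij
    by_cases hjm : j = m
    · refine hmin i (by omega) ⟨p, hp.take (by omega), q₁, q₂, hq, hadj₁, ?_⟩
      rw [hpij, hjm]
      exact hadj₂
    · have := hchord i (j + 1) (by omega) (by omega) (hpij ▸ hp.2 j (by omega))
      omega
  -- Every neighbour of `v` blocks some colour, which differs from `q₁` or from `q₂`; an inner
  -- neighbour would therefore end a shorter walk of this kind.
  have hint : ∀ i ≤ m, G.Adj v (p i) → i = 0 ∨ i = m := by
    intro i hi ha
    by_contra! hne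
    obtain ⟨r, hr⟩ := h.exists_adj hc hv hT (Finset.mem_of_mem_erase (hp.1 i hi)) ha
    by_cases hr₁ : r = q₁
    · obtain ⟨l, hl⟩ := Nat.exists_eq_add_of_le hi
      rw [hl] at hp hadj₂
      exact hmin l (by omega) ⟨_, hp.drop, r, q₂, hr₁ ▸ hq, hr, hadj₂⟩
    · exact hmin i (by omega) ⟨p, hp.take hi, q₁, r, Ne.symm hr₁, hadj₁, hr⟩
  have hvp : ∀ i ≤ m, p i ≠ v := fun i hi => Finset.ne_of_mem_erase (hp.1 i hi)
  set c : ℕ → V := fun t => if t = 0 then v else p (t - 1) with hcdef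
  have c0 : c 0 = v := by simp [hcdef]
  have cs : ∀ t, c (t + 1) = p t := fun t => by simp [hcdef]
  have hCS : cyc c (m + 2) ⊆ S := by
    intro x hx
    obtain ⟨i, hi, rfl⟩ := exists_of_mem_cyc hx
    rcases i with _ | i
    · exact c0 ▸ hv
    · rw [cs]
      exact Finset.mem_of_mem_erase (hp.1 i (by omega))
  have hvC : v ∈ cyc c (m + 2) := by
    rw [← c0]
    exact mem_cyc (by omega)
  have hsub : S \ cyc c (m + 2) ⊆ S.erase v := by
    intro x hx
    obtain ⟨hxS, hxC⟩ := Finset.mem_sdiff.1 hx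
    exact Finset.mem_erase.2 ⟨fun h' => hxC (h' ▸ hvC), hxS⟩
  have hcyc : IsCyc G c (m + 2) := by
    refine ⟨by omega, ?_, ?_⟩
    · intro i hi j hj hij
      rcases i with _ | i <;> rcases j with _ | j
      · rfl
      · rw [c0, cs] at hij
        exact absurd hij.symm (hvp j (by omega))
      · rw [c0, cs] at hij
        exact absurd hij (hvp i (by omega))
      · rw [cs, cs] at hij
        rcases lt_trichotomy i j with h' | h' | h'
        · exact absurd hij (hinj i j h' (by omega))
        · rw [h']
        · exact absurd hij.symm (hinj j i h' (by omega))
    · have hv0 : ∀ j ≤ m, G.Adj v (p j) ↔ j = 0 ∨ j = m := by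
        intro j hj
        refine ⟨hint j hj, ?_⟩
        rintro (rfl | rfl)
        · exact hc.base hadj₁
        · exact hc.base hadj₂
      have hpp : ∀ i j, i < j → j ≤ m → (G.Adj (p i) (p j) ↔ i + 1 = j) := by
        intro i j hij hj
        refine ⟨hchord i j hij hj, ?_⟩
        rintro rfl
        exact hp.2 i (by omega)
      intro i hi j hj
      rcases i with _ | i <;> rcases j with _ | j
      · simp
      · rw [c0, cs, hv0 j (by omega)]
        omega
      · rw [c0, cs, G.adj_comm, hv0 i (by omega)]
        omega
      · rw [cs, cs]
        rcases lt_trichotomy i j with h' | h' | h'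
        · rw [hpp i j h' (by omega)]
          omega
        · subst h'
          simp
        · rw [G.adj_comm, hpp j i h' (by omega)]
          omega
  have hpC : ∀ i ≤ m, p i ∈ cyc c (m + 2) := fun i hi => cs i ▸ mem_cyc (by omega)
  exact ⟨c, m + 2, T, hcyc, hCS, hT.mono hsub, c0, q₁, q₂, hq,
    h.residual_pos hc hCS hvC hT (hpC 0 (by omega)) hadj₁,
    h.residual_pos hc hCS hvC hT (hpC m le_rfl) hadj₂⟩

/-- A critical block with two colours is complete or a cycle. -/
theorem Crit.isClique_or_cyc [Nonempty (Fin κ)] (hc : IsCover G H) (h : Crit G H g S)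
    (hS : Block G S) (hv : v ∈ S) (ht : Two g v) :
    G.IsClique (S : Set V) ∨ ∃ c n, IsCyc G c n ∧ 4 ≤ n ∧ cyc c n = S := by
  obtain ⟨c, n, φ, hcyc, hsub, hφ, rfl, ht'⟩ := h.exists_cyc hc hS hv ht
  have h3 := hcyc.three_le
  by_cases hn : n = 3
  · left
    subst hn
    have hC : cyc c 3 = {c 0, c 1, c 2} := by
      ext x
      simp [cyc, Finset.range_add_one]
      tauto
    rw [hC] at hsub hφ ht'
    exact h.isClique_of_triangle hc hS hsub ((hcyc.adj 0 (by omega) 1 (by omega)).2 (by omega))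
      ((hcyc.adj 1 (by omega) 2 (by omega)).2 (by omega))
      ((hcyc.adj 0 (by omega) 2 (by omega)).2 (by omega)) hφ ht'
  · exact Or.inr ⟨c, n, hcyc, by omega, h.eq_cyc hc hS hcyc (by omega) hsub hφ
      (mem_cyc (by omega)) ht'⟩

/-! ### Recognising the building covers. -/

section

variable {c : ℕ → V} {n : ℕ} {f : V × Fin κ → ℕ}

theorem deg_eq_dg [Fintype V] (v : V) : deg G v = dg G univ v := by
  unfold deg dg
  rw [← Set.ncard_coe_finset]
  congr 1
  ext u
  simp

theorem Crit.sum_pos [Nonempty (Fin κ)] (hc : IsCover G H) (h : Crit G H g S)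
    (hS : Block G S) (hv : v ∈ S) : ∃ q, 0 < g (v, q) := by
  by_contra! hcon
  obtain ⟨u, hu, hvu⟩ := hS.1.exists_adj hv (by
    rintro rfl
    simpa using (hS.2 v hv).1)
  have h1 := h.sum_eq hc hv
  rw [Finset.sum_eq_zero fun q _ => Nat.le_zero.1 (hcon q)] at h1
  have : 0 < dg G S v := Finset.card_pos.2 ⟨u, Finset.mem_filter.2 ⟨hu, hvu⟩⟩
  omega

/-- The projection of the kernel is a bijection, since each fibre has exactly one positive colour;
`Crit.exists_match` then lifts every edge. -/
theorem Crit.kernelIsBase [Fintype V] [Nonempty (Fin κ)] (hc : IsCover G H)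
    (h : Crit G H f univ) (hS : Block G (univ : Finset V)) (ht : ∀ v, ¬ Two f v) :
    KernelIsBase G H f := by
  have huniq : ∀ x y : support f, x.1.1 = y.1.1 → x = y := by
    rintro ⟨⟨v, q⟩, hx⟩ ⟨⟨u, r⟩, hy⟩ (rfl : v = u)
    by_contra hne
    refine ht v ⟨q, r, ?_, Nat.pos_of_ne_zero hx, Nat.pos_of_ne_zero hy⟩
    rintro rfl
    exact hne rfl
  refine ⟨⟨Equiv.ofBijective (fun x => x.1.1) ⟨fun x y hxy => huniq x y hxy, fun v => ?_⟩, ?_⟩⟩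
  · obtain ⟨q, hq⟩ := h.sum_pos hc hS (Finset.mem_univ v)
    exact ⟨⟨(v, q), hq.ne'⟩, rfl⟩
  · intro x y
    change G.Adj x.1.1 y.1.1 ↔ H.Adj x.1 y.1
    refine ⟨fun hxy => ?_, fun hxy => hc.adj_base _ _ hxy⟩
    obtain ⟨q, hq, hpos⟩ := h.exists_match hc (Finset.mem_univ x.1.1)
      (hS.2 _ (Finset.mem_univ _)) (Finset.mem_univ y.1.1) hxy (q := x.1.2)
      (Nat.pos_of_ne_zero x.2)
    rw [← huniq ⟨(y.1.1, q), hpos.ne'⟩ y rfl]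
    exact hq

/-- Layers are indexed by the positive colours of `v`: a kernel vertex belongs to the colour it is
matched to over `v`. `Crit.clique_trans` makes each layer a clique meeting every fibre once, and
`uniform_of_isClique` makes `f` constant on it. -/
theorem Crit.kernelIsLayeredComplete [Fintype V] [Nonempty (Fin κ)] (hc : IsCover G H)
    (h : Crit G H f univ) (hS : Block G (univ : Finset V))
    (hclique : G.IsClique ((univ : Finset V) : Set V)) (ht : Two f v) :
    KernelIsLayeredComplete G H f := by
  have hadj : ∀ x y, x ≠ y → G.Adj x y := fun x y hxy =>
    hclique (Finset.mem_coe.2 (Finset.mem_univ x)) (Finset.mem_coe.2 (Finset.mem_univ y)) hxy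
  have hm : ∀ {u w : V} {q : Fin κ}, w ≠ u → f (w, q) ≠ 0 →
      ∃ q', H.Adj (w, q) (u, q') ∧ f (u, q') ≠ 0 := by
    intro u w q hne hq
    obtain ⟨q', h₁, h₂⟩ := h.exists_match hc (Finset.mem_univ w)
      (hS.2 _ (Finset.mem_univ _)) (Finset.mem_univ u) (hadj _ _ hne) (Nat.pos_of_ne_zero hq)
    exact ⟨q', h₁, h₂.ne'⟩
  have htrans : ∀ {x y z : V × Fin κ}, x.1 ≠ z.1 → f x ≠ 0 → f y ≠ 0 → f z ≠ 0 → H.Adj x y →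
      H.Adj y z → H.Adj x z := fun hxz hx hy hz hxy hyz =>
    h.clique_trans hc hclique (Finset.mem_univ v) ht (Finset.mem_univ _) (Finset.mem_univ _)
      (Finset.mem_univ _) hxz hxy hyz (Nat.pos_of_ne_zero hx) (Nat.pos_of_ne_zero hy)
      (Nat.pos_of_ne_zero hz)
  have hirr : ∀ {x y : V × Fin κ}, x.1 = y.1 → ¬ H.Adj x y := fun hxy h' =>
    (hc.adj_base _ _ h').ne hxy
  have hL : ∀ x : support f, ∃ r : {q // f (v, q) ≠ 0}, x.1 = (v, r.1) ∨ H.Adj x.1 (v, r.1) := by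
    rintro ⟨⟨u, q⟩, hx⟩
    by_cases huv : u = v
    · subst huv
      exact ⟨⟨q, hx⟩, Or.inl rfl⟩
    · obtain ⟨q', h₁, h₂⟩ := hm huv hx
      exact ⟨⟨q', h₂⟩, Or.inr h₁⟩
  choose L hL using hL
  have hLu : ∀ (x : support f) (r : {q // f (v, q) ≠ 0}),
      x.1 = (v, r.1) ∨ H.Adj x.1 (v, r.1) → L x = r := by
    intro x r hr
    apply Subtype.ext
    rcases hL x with h₁ | h₁ <;> rcases hr with h₂ | h₂
    · exact congrArg Prod.snd (h₁.symm.trans h₂)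
    · exact absurd h₂ (hirr (by rw [h₁]))
    · exact absurd h₁ (hirr (by rw [h₂]))
    · exact hc.eq_of_adj h₁ h₂
  have key₁ : ∀ x y : support f, H.Adj x.1 y.1 → L x = L y := by
    intro x y hxy
    rcases hL x with h₁ | h₁
    · exact (hLu y (L x) (Or.inr (h₁ ▸ hxy.symm))).symm
    rcases hL y with h₂ | h₂
    · exact hLu x (L y) (Or.inr (h₂ ▸ hxy))
    · exact hLu x (L y) (Or.inr (htrans (hc.adj_base _ _ h₁).ne x.2 y.2 (L y).2 hxy h₂))
  have key₂ : ∀ x y : support f, L x = L y → x.1.1 ≠ y.1.1 → H.Adj x.1 y.1 := by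
    intro x y hxy hne
    have h₁ := hL x
    have h₂ := hL y
    rw [hxy] at h₁
    rcases h₁ with h₁ | h₁ <;> rcases h₂ with h₂ | h₂
    · exact absurd (by rw [h₁, h₂]) hne
    · exact h₁ ▸ h₂.symm
    · exact h₂ ▸ h₁
    · exact htrans hne x.2 (L y).2 y.2 h₁ h₂.symm
  have key₃ : ∀ x y : support f, L x = L y → x.1.1 = y.1.1 → x = y := by
    intro x y hxy hxy'
    have h₁ := hL x
    have h₂ := hL y
    rw [hxy] at h₁
    apply Subtype.ext
    rcases h₁ with h₁ | h₁ <;> rcases h₂ with h₂ | h₂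
    · exact h₁.trans h₂.symm
    · exact absurd h₂ (hirr (by rw [← hxy', h₁]))
    · exact absurd h₁ (hirr (by rw [hxy', h₂]))
    · exact hc.matching _ _ _ h₁.symm h₂.symm hxy'
  have key₄ : ∀ u r, ∃ x : support f, x.1.1 = u ∧ L x = r := by
    rintro u ⟨r, hr⟩
    by_cases huv : u = v
    · subst huv
      exact ⟨⟨(u, r), hr⟩, rfl, hLu _ _ (Or.inl rfl)⟩
    · obtain ⟨q', h₁, h₂⟩ := hm (Ne.symm huv) hr
      exact ⟨⟨(u, q'), h₂⟩, rfl, hLu _ _ (Or.inr h₁.symm)⟩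
  let eV := Fintype.equivFin V
  let eL := Fintype.equivFin {q // f (v, q) ≠ 0}
  refine ⟨_, _, ?_, ⟨⟨eV, ?_⟩⟩, ⟨⟨Equiv.ofBijective (fun x => (eV x.1.1, eL (L x))) ⟨?_, ?_⟩, ?_⟩⟩, ?_⟩
  · obtain ⟨u, hu⟩ := (hS.2 v (Finset.mem_univ v)).1
    exact Fintype.one_lt_card_iff.2 ⟨u, v, Finset.ne_of_mem_erase hu⟩
  · intro x y
    simp only [SimpleGraph.top_adj, ne_eq, EmbeddingLike.apply_eq_iff_eq]
    exact ⟨hadj x y, fun h' => h'.ne⟩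
  · intro x y hxy
    simp only [Prod.mk.injEq, EmbeddingLike.apply_eq_iff_eq] at hxy
    exact key₃ x y hxy.2 hxy.1
  · rintro ⟨i, j⟩
    obtain ⟨x, hx₁, hx₂⟩ := key₄ (eV.symm i) (eL.symm j)
    exact ⟨x, by simp [hx₁, hx₂]⟩
  · intro x y
    change (layeredComplete _ _).Adj (eV x.1.1, eL (L x)) (eV y.1.1, eL (L y)) ↔ H.Adj x.1 y.1
    simp only [layeredComplete, SimpleGraph.boxProd_adj, SimpleGraph.top_adj, SimpleGraph.bot_adj,
      ne_eq, EmbeddingLike.apply_eq_iff_eq, false_and, or_false]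
    exact ⟨fun h' => key₂ x y h'.2 h'.1, fun h' => ⟨(hc.adj_base _ _ h').ne, key₁ x y h'⟩⟩
  · rintro x y ⟨p⟩
    induction p with
    | nil => rfl
    | @cons x y z hxy _ ih =>
      rw [← ih]
      exact uniform_of_isClique hc hclique f h ⟨v, Finset.mem_univ v, ht⟩ _ (Finset.mem_univ _) _
        (Finset.mem_univ _) _ _ hxy (Nat.pos_of_ne_zero x.2) (Nat.pos_of_ne_zero y.2)

/-- The condition `n ≠ 1` removes the loop that the wrap-around clauses would create on one vertex.
-/
theorem cycleGraph_adj_iff_val (i j : Fin n) : (SimpleGraph.cycleGraph n).Adj i j ↔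
    n ≠ 1 ∧ (i.val + 1 = j.val ∨ j.val + 1 = i.val ∨ (i.val = 0 ∧ j.val + 1 = n) ∨
      (j.val = 0 ∧ i.val + 1 = n)) := by
  have hsub : ∀ i j : Fin n, (i - j).val = 1 ↔
      n ≠ 1 ∧ (j.val + 1 = i.val ∨ (i.val = 0 ∧ j.val + 1 = n)) := by
    intro i j
    have hi := i.2
    have hj := j.2
    rw [Fin.sub_def]
    dsimp only
    by_cases hij : j.val ≤ i.val
    · rw [show n - j.val + i.val = n + (i.val - j.val) by omega, Nat.add_mod_left,
        Nat.mod_eq_of_lt (by omega)]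
      omega
    · rw [Nat.mod_eq_of_lt (by omega)]
      omega
  rw [SimpleGraph.cycleGraph_adj', hsub, hsub]
  tauto

theorem eq_or_eq_of_sum_le_two (h : ∑ q, g (v, q) ≤ 2) {q₁ q₂ : Fin κ} (hne : q₁ ≠ q₂)
    (h₁ : 0 < g (v, q₁)) (h₂ : 0 < g (v, q₂)) (hq : 0 < g (v, q)) : q = q₁ ∨ q = q₂ := by
  by_contra! hcon
  have := Finset.sum_le_sum_of_subset (f := fun q => g (v, q)) (Finset.subset_univ {q, q₁, q₂})
  rw [Finset.sum_insert (by simp [hcon]), Finset.sum_pair hne] at this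
  omega

/-- Two sheets `a 0`, `a 1` of a cover of the cycle `c`, closed up by the permutation `τ`. -/
structure IsSheets (H : SimpleGraph (V × Fin κ)) (f : V × Fin κ → ℕ) (c : ℕ → V) (n : ℕ)
    (a : Fin 2 → ℕ → Fin κ) (τ : Fin 2 → Fin 2) : Prop where
  pos : ∀ j, ∀ i < n, f (c i, a j i) = 1
  exhaust : ∀ i < n, ∀ q, f (c i, q) ≠ 0 → ∃ j, a j i = q
  inj : ∀ i < n, ∀ j j', a j i = a j' i → j = j'
  adj : ∀ i < n, ∀ i' < n, ∀ j j', H.Adj (c i, a j i) (c i', a j' i') ↔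
    (i + 1 = i' ∧ j = j') ∨ (i' + 1 = i ∧ j = j') ∨ (i + 1 = n ∧ i' = 0 ∧ τ j = j') ∨
      (i' + 1 = n ∧ i = 0 ∧ τ j' = j)

theorem Crit.exists_sheets [Nonempty (Fin κ)] (hc : IsCover G H) (hcyc : IsCyc G c n)
    (h : Crit G H f (cyc c n)) (hv : v ∈ cyc c n) (ht : Two f v) :
    ∃ a τ, IsSheets H f c n a τ ∧ Function.Injective τ := by
  have hn := hcyc.three_le
  have hone : ∀ i < n, ∀ q, f (c i, q) ≠ 0 → f (c i, q) = 1 := fun i hi q hq =>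
    hcyc.eq_one hc h ⟨v, hv, ht⟩ (mem_cyc hi) (Nat.pos_of_ne_zero hq)
  have hm : ∀ i < n, ∀ i' < n, G.Adj (c i) (c i') → ∀ q, 0 < f (c i, q) →
      ∃ q', H.Adj (c i, q) (c i', q') ∧ 0 < f (c i', q') := fun i hi i' hi' ha q hq =>
    h.exists_match hc (mem_cyc hi) (hcyc.block.2 _ (mem_cyc hi)) (mem_cyc hi') ha hq
  obtain ⟨q₁, q₂, hq, hq₁, hq₂⟩ := h.two hc hcyc.block hv (mem_cyc (i := 0) (by omega)) ht
  -- A total successor function on colours; its value beyond the last index or at a colour of value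
  -- 0 plays no role.
  have hstep : ∀ i q, ∃ q', i + 1 < n → 0 < f (c i, q) →
      H.Adj (c i, q) (c (i + 1), q') ∧ 0 < f (c (i + 1), q') := by
    intro i q
    by_cases h' : i + 1 < n ∧ 0 < f (c i, q)
    · obtain ⟨q', hq'⟩ := hm i (by omega) (i + 1) h'.1
        ((hcyc.adj _ (by omega) _ (by omega)).2 (by omega)) q h'.2
      exact ⟨q', fun _ _ => hq'⟩
    · exact ⟨q, fun h₁ h₂ => absurd ⟨h₁, h₂⟩ h'⟩
  choose nx hnx using hstep
  let a : Fin 2 → ℕ → Fin κ := fun j i => Nat.rec (if j = 0 then q₁ else q₂) nx i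
  have a0 : ∀ j, a j 0 = if j = 0 then q₁ else q₂ := fun j => rfl
  have as : ∀ j i, a j (i + 1) = nx i (a j i) := fun j i => rfl
  have hpos : ∀ j, ∀ i < n, 0 < f (c i, a j i) := by
    intro j i hi
    induction i with
    | zero =>
      rw [a0]
      split_ifs
      · exact hq₁
      · exact hq₂
    | succ i ih => exact as j i ▸ (hnx i _ hi (ih (by omega))).2
  have hadj : ∀ j i, i + 1 < n → H.Adj (c i, a j i) (c (i + 1), a j (i + 1)) := by
    intro j i hi
    rw [as]
    exact (hnx i _ hi (hpos j i (by omega))).1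
  have hinj : ∀ i < n, ∀ j j', a j i = a j' i → j = j' := by
    intro i hi j j'
    induction i with
    | zero =>
      rw [a0, a0]
      have hq' := hq.symm
      fin_cases j <;> fin_cases j' <;> simp_all
    | succ i ih =>
      intro he
      apply ih (by omega)
      have h₁ := hadj j i hi
      rw [he] at h₁
      exact hc.eq_of_adj' h₁ (hadj j' i hi)
  have hex : ∀ i < n, ∀ q, f (c i, q) ≠ 0 → ∃ j, a j i = q := by
    intro i hi q hq'
    have hsum : ∑ q, f (c i, q) ≤ 2 := by
      rw [h.sum_eq hc (mem_cyc hi)]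
      exact hcyc.dg_le (mem_cyc hi)
    rcases eq_or_eq_of_sum_le_two hsum (fun h' => absurd (hinj i hi 0 1 h') (by decide))
      (hpos 0 i hi) (hpos 1 i hi) (Nat.pos_of_ne_zero hq') with h' | h'
    · exact ⟨0, h'.symm⟩
    · exact ⟨1, h'.symm⟩
  have hlast : ∀ j, ∃ j', H.Adj (c (n - 1), a j (n - 1)) (c 0, a j' 0) := by
    intro j
    obtain ⟨q, h₁, h₂⟩ := hm (n - 1) (by omega) 0 (by omega)
      ((hcyc.adj _ (by omega) _ (by omega)).2 (by omega)) _ (hpos j (n - 1) (by omega))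
    obtain ⟨j', rfl⟩ := hex 0 (by omega) q h₂.ne'
    exact ⟨j', h₁⟩
  choose τ hτ using hlast
  refine ⟨a, τ, ⟨fun j i hi => hone i hi _ (hpos j i hi).ne', hex, hinj, ?_⟩, ?_⟩
  · intro i hi i' hi' j j'
    have hlast' : ∀ {i i' j j'}, i + 1 = n → i' = 0 →
        (H.Adj (c i, a j i) (c i', a j' i') ↔ τ j = j') := by
      intro i i' j j' hi h0
      obtain rfl : i = n - 1 := by omega
      subst h0
      refine ⟨fun h' => hinj 0 (by omega) _ _ (hc.eq_of_adj (hτ j) h'), ?_⟩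
      rintro rfl
      exact hτ j
    have hnext : ∀ {i i' j j'}, i' < n → i + 1 = i' →
        (H.Adj (c i, a j i) (c i', a j' i') ↔ j = j') := by
      rintro i _ j j' hi rfl
      refine ⟨fun h' => hinj _ hi _ _ (hc.eq_of_adj (hadj j i hi) h'), ?_⟩
      rintro rfl
      exact hadj j i hi
    constructor
    · intro h'
      rcases (hcyc.adj i hi i' hi').1 (hc.base h') with h'' | h'' | h'' | h''
      · exact Or.inl ⟨h'', (hnext hi' h'').1 h'⟩
      · exact Or.inr (Or.inl ⟨h'', ((hnext hi h'').1 h'.symm).symm⟩)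
      · exact Or.inr (Or.inr (Or.inr ⟨h''.2, h''.1, (hlast' h''.2 h''.1).1 h'.symm⟩))
      · exact Or.inr (Or.inr (Or.inl ⟨h''.2, h''.1, (hlast' h''.2 h''.1).1 h'⟩))
    · rintro (⟨h₁, h₂⟩ | ⟨h₁, h₂⟩ | ⟨h₁, h₂, h₃⟩ | ⟨h₁, h₂, h₃⟩)
      · exact (hnext hi' h₁).2 h₂
      · exact ((hnext hi h₁).2 h₂.symm).symm
      · exact (hlast' h₁ h₂).2 h₃
      · exact ((hlast' h₁ h₂).2 h₃).symm
  · intro j j' hjj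
    apply hinj (n - 1) (by omega)
    have := hτ j
    rw [hjj] at this
    exact hc.eq_of_adj' this (hτ j')

/-- Alternating the sheets by the parity of the index leaves only the closing edge as a possible
conflict, and the condition on `τ` sends the sheet used last away from the sheet used at index 0. -/
theorem IsSheets.colorable {a : Fin 2 → ℕ → Fin κ} {τ : Fin 2 → Fin 2}
    (h : IsSheets H f c n a τ) (hτ : ∀ j, τ j = j ↔ Even n) : Colorable H f (cyc c n) := by
  have hidx : ∀ v, ∃ i, v ∈ cyc c n → i < n ∧ c i = v := by
    intro v
    by_cases hv : v ∈ cyc c n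
    · obtain ⟨i, hi⟩ := exists_of_mem_cyc hv
      exact ⟨i, fun _ => hi⟩
    · exact ⟨0, fun h' => absurd h' hv⟩
  choose idx hidx using hidx
  let par : ℕ → Fin 2 := fun i => ⟨i % 2, Nat.mod_lt _ (by norm_num)⟩
  refine ⟨fun v => a (par (idx v)) (idx v), good_of_indep ?_ ?_⟩
  · intro v hv
    obtain ⟨hi, hci⟩ := hidx v hv
    have := h.pos (par (idx v)) _ hi
    rw [hci] at this
    omega
  · intro v hv u hu hadj
    obtain ⟨hi, hci⟩ := hidx v hv
    obtain ⟨hi', hci'⟩ := hidx u hu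
    have h₁ := (h.adj _ hi _ hi' (par (idx v)) (par (idx u))).1 (by rwa [hci, hci'])
    have hwrap : ∀ i, i + 1 = n → τ (par i) ≠ par 0 := by
      intro i hi he
      have h₂ := hτ (par i)
      rw [Nat.even_iff, he, Fin.ext_iff] at h₂
      simp only [par] at h₂
      omega
    rcases h₁ with ⟨h₁, h₂⟩ | ⟨h₁, h₂⟩ | ⟨h₁, h₂, h₃⟩ | ⟨h₁, h₂, h₃⟩
    · simp only [par, Fin.mk.injEq] at h₂
      omega
    · simp only [par, Fin.mk.injEq] at h₂
      omega
    · exact hwrap _ h₁ (h₂ ▸ h₃)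
    · exact hwrap _ h₁ (h₂ ▸ h₃)

theorem IsCyc.iso (h : IsCyc G c n) (huniv : ∀ v, v ∈ cyc c n) :
    Nonempty (G ≃g SimpleGraph.cycleGraph n) := by
  have hn := h.three_le
  refine ⟨RelIso.symm ⟨Equiv.ofBijective (fun i : Fin n => c i.val) ⟨?_, ?_⟩, ?_⟩⟩
  · exact fun i j hij => Fin.ext (h.inj _ i.2 _ j.2 hij)
  · intro v
    obtain ⟨i, hi, hv⟩ := exists_of_mem_cyc (huniv v)
    exact ⟨⟨i, hi⟩, hv⟩
  · intro i j
    change G.Adj (c i.val) (c j.val) ↔ _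
    rw [h.adj _ i.2 _ j.2, cycleGraph_adj_iff_val]
    omega

theorem IsSheets.iso {a : Fin 2 → ℕ → Fin κ} {τ : Fin 2 → Fin 2} (hcyc : IsCyc G c n)
    (h : IsSheets H f c n a τ) (huniv : ∀ v, v ∈ cyc c n) (L : SimpleGraph (Fin n × Fin 2))
    (hL : ∀ i j i' j', L.Adj (i, j) (i', j') ↔
      (i.val + 1 = i'.val ∧ j = j') ∨ (i'.val + 1 = i.val ∧ j = j') ∨
      (i.val + 1 = n ∧ i'.val = 0 ∧ τ j = j') ∨ (i'.val + 1 = n ∧ i.val = 0 ∧ τ j' = j)) :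
    Nonempty (kernel H f ≃g L) := by
  refine ⟨RelIso.symm ⟨Equiv.ofBijective (fun x : Fin n × Fin 2 =>
    (⟨(c x.1.val, a x.2 x.1.val), by
      change f _ ≠ 0
      rw [h.pos _ _ x.1.2]
      exact one_ne_zero⟩ : support f)) ⟨?_, ?_⟩, ?_⟩⟩
  · rintro ⟨i, j⟩ ⟨i', j'⟩ he
    simp only [Subtype.mk.injEq, Prod.mk.injEq] at he
    obtain rfl : i = i' := Fin.ext (hcyc.inj _ i.2 _ i'.2 he.1)
    rw [h.inj _ i.2 _ _ he.2]
  · rintro ⟨⟨v, q⟩, hx⟩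
    obtain ⟨i, hi, rfl⟩ := exists_of_mem_cyc (huniv v)
    obtain ⟨j, rfl⟩ := h.exhaust i hi q hx
    exact ⟨(⟨i, hi⟩, j), rfl⟩
  · rintro ⟨i, j⟩ ⟨i', j'⟩
    change H.Adj (c i.val, a j i.val) (c i'.val, a j' i'.val) ↔ _
    rw [h.adj _ i.2 _ i'.2, hL]

theorem fin_two_injective {τ : Fin 2 → Fin 2} (hτ : Function.Injective τ) :
    (∀ j, τ j = j) ∨ ∀ j j', τ j = j' ↔ j ≠ j' := by
  revert hτ τ
  decide

theorem Crit.kernel_cyc [Fintype V] [Nonempty (Fin κ)] (hc : IsCover G H)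
    (h : Crit G H f univ) (hcyc : IsCyc G c n) (huniv : cyc c n = univ) (ht : Two f v) :
    KernelIsCircularLadder G H f ∨ KernelIsMobiusLadder G H f := by
  have hn := hcyc.three_le
  rw [← huniv] at h
  have hu : ∀ v, v ∈ cyc c n := fun v => huniv ▸ Finset.mem_univ v
  obtain ⟨a, τ, hs, hτ⟩ := h.exists_sheets hc hcyc (hu v) ht
  have hone : ∀ x ∈ support f, f x = 1 := by
    rintro ⟨v, q⟩ hx
    obtain ⟨i, hi, rfl⟩ := exists_of_mem_cyc (hu v)
    obtain ⟨j, rfl⟩ := hs.exhaust i hi q hx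
    exact hs.pos j i hi
  rcases fin_two_injective hτ with hid | hsw
  · by_cases he : Even n
    · exact absurd (hs.colorable fun j => by simp [hid, he]) h.bad
    · refine Or.inl ⟨n, hn, Nat.not_even_iff_odd.1 he, hcyc.iso hu, hs.iso hcyc hu _ ?_, hone⟩
      intro i j i' j'
      simp only [circularLadder, SimpleGraph.boxProd_adj, SimpleGraph.bot_adj, false_and, or_false,
        cycleGraph_adj_iff_val, hid]
      have h1 : n ≠ 1 := by omega
      rw [eq_comm (a := j') (b := j)]
      tauto
  · by_cases he : Even n
    · refine Or.inr ⟨n, hn, he, hcyc.iso hu, hs.iso hcyc hu _ ?_, hone⟩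
      intro i j i' j'
      simp only [mobiusLadder, SimpleGraph.fromRel_adj, hsw, ne_eq, Prod.mk.injEq, not_and,
        Fin.ext_iff]
      omega
    · exact absurd (hs.colorable fun j => by simp [hsw, he]) h.bad

theorem Crit.isBuildingCover [Fintype V] [Nonempty (Fin κ)] (hc : IsCover G H)
    (h : Crit G H f univ) (hS : Block G (univ : Finset V)) : IsBuildingCover G H f where
  finite := inferInstance
  cover := hc
  degree v := by rw [deg_eq_dg, h.sum_eq hc (Finset.mem_univ v)]
  type := by
    by_cases ht : ∃ v, Two f v
    · obtain ⟨v, ht⟩ := ht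
      rcases h.isClique_or_cyc hc hS (Finset.mem_univ v) ht with h' | ⟨c, n, hcyc, -, hu⟩
      · exact Or.inr (Or.inl (h.kernelIsLayeredComplete hc hS h' ht))
      · exact Or.inr (Or.inr (h.kernel_cyc hc hcyc hu ht))
    · push Not at ht
      exact Or.inl (h.kernelIsBase hc hS ht)

end

/-! ### Splitting at cut vertices, and the induction. -/

section

variable {f : V × Fin κ → ℕ}

theorem Good.congr_left {g' : V × Fin κ → ℕ} (h : Good H g φ S)
    (h' : ∀ v ∈ S, ∀ q, g (v, q) = g' (v, q)) : Good H g' φ S := by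
  intro A hA hne
  obtain ⟨v, hv, hlt⟩ := h A hA hne
  exact ⟨v, hv, h' v (hA hv) _ ▸ hlt⟩

/-- Since `w` is the only exit from `A`, an edge of `S` leaving a subset of `A` stays in `insert w
A`. A subset containing `w` is handled through its complement. -/
theorem Conn.insert_of_closed (hS : Conn G S) (hw : w ∈ S) (hA : A ⊆ S)
    (hcl : ∀ a ∈ A, ∀ b ∈ S, b ≠ w → b ∉ A → ¬ G.Adj a b) : Conn G (insert w A) := by
  refine ⟨by simp, fun B hB hne hBne => ?_⟩
  have hin : ∀ a ∈ A, ∀ b ∈ S, G.Adj a b → b ∈ insert w A := by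
    intro a ha b hb hab
    by_contra h'
    rw [Finset.mem_insert, not_or] at h'
    exact hcl a ha b hb h'.1 h'.2 hab
  have hside : ∀ C ⊆ insert w A, C.Nonempty → w ∉ C →
      ∃ a ∈ C, ∃ b ∈ insert w A, b ∉ C ∧ G.Adj a b := by
    intro C hC hCne hwC
    have hCA : C ⊆ A := fun x hx => (Finset.mem_insert.1 (hC hx)).resolve_left
      (by rintro rfl; exact hwC hx)
    obtain ⟨a, ha, b, hb, hbC, hab⟩ := hS.2 C (hCA.trans hA) hCne (by rintro rfl; exact hwC hw)
    exact ⟨a, ha, b, hin a (hCA ha) b hb hab, hbC, hab⟩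
  by_cases hwB : w ∈ B
  · obtain ⟨x, hx, hxB⟩ := Finset.exists_of_ssubset (hB.ssubset_of_ne hBne)
    obtain ⟨a, ha, b, hb, hb', hab⟩ := hside (insert w A \ B) Finset.sdiff_subset
      ⟨x, Finset.mem_sdiff.2 ⟨hx, hxB⟩⟩ (by simp [hwB])
    obtain ⟨ha, haB⟩ := Finset.mem_sdiff.1 ha
    refine ⟨b, ?_, a, ha, haB, hab.symm⟩
    by_contra h'
    exact hb' (Finset.mem_sdiff.2 ⟨hb, h'⟩)
  · exact hside B hB hne hwB

/-- A critical configuration splits at a cut vertex. -/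
theorem Crit.exists_split [Fintype V] [Nonempty (Fin κ)] (hc : IsCover G H)
    (h : Crit G H f univ) {A B : Finset V} (hwA : w ∉ A) (hwB : w ∉ B) (hAB : Disjoint A B)
    (hun : insert w A ∪ B = univ) (hno : ∀ a ∈ A, ∀ b ∈ B, ¬ G.Adj a b) :
    ∃ f₁ f₂ : V × Fin κ → ℕ, Crit G H f₁ (insert w A) ∧ Crit G H f₂ (insert w B) ∧
      (∀ q, f (w, q) = f₁ (w, q) + f₂ (w, q)) ∧ (∀ v ∈ A, ∀ q, f (v, q) = f₁ (v, q)) ∧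
      ∀ v ∈ B, ∀ q, f (v, q) = f₂ (v, q) := by
  have hmem : ∀ x, x = w ∨ x ∈ A ∨ x ∈ B := by
    intro x
    have := Finset.mem_univ x
    rw [← hun] at this
    simpa [or_assoc] using this
  have hA : (univ : Finset V) \ insert w A = B := by
    rw [← hun, Finset.union_sdiff_left, Finset.sdiff_eq_self_of_disjoint]
    exact Finset.disjoint_insert_right.2 ⟨hwB, hAB.symm⟩
  have hB : (univ : Finset V) \ insert w B = A := by
    ext x
    have h₁ := hmem x
    have h₂ : x ∈ A → x ∉ B := fun h => Finset.disjoint_left.1 hAB h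
    have h₃ : x = w → x ∉ A := by rintro rfl; exact hwA
    simp only [Finset.mem_sdiff, Finset.mem_univ, true_and, Finset.mem_insert]
    tauto
  have hc₁ : Conn G (insert w A) := h.conn.insert_of_closed (Finset.mem_univ w)
    (Finset.subset_univ _) fun a ha b _ hbw hbA =>
      hno a ha b (((hmem b).resolve_left hbw).resolve_left hbA)
  have hc₂ : Conn G (insert w B) := h.conn.insert_of_closed (Finset.mem_univ w)
    (Finset.subset_univ _) fun a ha b _ hbw hbB hab =>
      hno b (((hmem b).resolve_left hbw).resolve_right hbB) a ha hab.symm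
  obtain ⟨φ, hφ⟩ := h.conn.colorable_sdiff hc h.valid (Finset.subset_univ _) hc₁.1
  obtain ⟨T, hT⟩ := h.conn.colorable_sdiff hc h.valid (Finset.subset_univ _) hc₂.1
  have hk := h.residual hc (Finset.subset_univ _) hc₁ hφ
  rw [hA] at hφ hk
  rw [hB] at hT
  set f₁ := res H f φ B with hf₁
  have hle : ∀ x, f₁ x ≤ f x := res_le f φ B
  have hfA : ∀ v ∈ A, ∀ q, f (v, q) = f₁ (v, q) := by
    intro v hv q
    simp only [hf₁, res]
    rw [cnt_eq_zero fun u hu hadj => hno v hv u hu (hc.base hadj), Nat.sub_zero]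
  -- Exact blocking for `f₁`: the transversal `T` over `A` blocks precisely `f₁` at `w`. The second
  -- function is therefore what `T` leaves over `insert w B`, and a transversal for it would
  -- complete `T`.
  have hcnt : ∀ q, cnt H T A w q = f₁ (w, q) := by
    intro q
    rw [← hk.cnt_eq hc (Finset.mem_insert_self w A) (φ := T), Finset.erase_insert hwA]
    rw [Finset.erase_insert hwA]
    exact hT.congr_left hfA
  refine ⟨f₁, fun x => if x.1 = w then f x - f₁ x else f x, hk, ⟨hc₂, ?_, ?_⟩, ?_, hfA, ?_⟩
  · intro v hv
    rcases Finset.mem_insert.1 hv with rfl | hvB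
    · have h₁ := hk.sum_eq hc (Finset.mem_insert_self v A)
      have h₂ := h.valid v (Finset.mem_univ v)
      have h₃ : dg G univ v = dg G (insert v A) v + dg G B v := by
        rw [← dg_union, hun]
        exact Finset.disjoint_insert_left.2 ⟨hwB, hAB⟩
      have h₄ : dg G (insert v B) v = dg G B v := by
        unfold dg
        rw [Finset.filter_insert, if_neg (G.irrefl)]
      have h₅ : ∑ q, f (v, q) = ∑ q, (f (v, q) - f₁ (v, q)) + ∑ q, f₁ (v, q) := by
        rw [← Finset.sum_add_distrib]
        exact Finset.sum_congr rfl fun q _ => (Nat.sub_add_cancel (hle _)).symm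
      simp only [if_true]
      omega
    · have hvw : v ≠ w := by rintro rfl; exact hwB hvB
      simp only [hvw, if_false]
      exact (dg_mono (Finset.subset_univ _) v).trans (h.valid v (Finset.mem_univ v))
  · rintro ⟨ψ, hψ⟩
    apply h.bad
    have hd : Disjoint A (insert w B) := Finset.disjoint_insert_right.2 ⟨hwA, hAB⟩
    have hu : A ∪ insert w B = univ := by
      rw [← hun]
      ext x
      simp only [Finset.mem_union, Finset.mem_insert]
      tauto
    refine ⟨_, hu ▸ hT.piecewise hd (ψ := ψ) (hψ.congr_left ?_)⟩
    intro v hv q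
    rcases Finset.mem_insert.1 hv with rfl | hvB
    · simp only [if_true, res, hcnt]
    · have hvw : v ≠ w := by rintro rfl; exact hwB hvB
      simp only [hvw, if_false, res]
      rw [cnt_eq_zero fun u hu hadj => hno u hu v hvB (hc.base hadj.symm), Nat.sub_zero]
  · intro q
    simp only [if_true]
    have := hle (w, q)
    omega
  · intro v hv q
    have hvw : v ≠ w := by rintro rfl; exact hwB hv
    simp only [hvw, if_false]

/-! ### Restriction along an embedding of vertex sets. -/

section Transfer

variable {V₁ : Type*} (e : V₁ ↪ V)

theorem IsCover.comap (hc : IsCover G H) :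
    IsCover (G.comap e) (H.comap (liftEmb κ e)) where
  adj_base _ _ h := hc.adj_base _ _ h
  matching _ _ _ h h' hyz := (liftEmb κ e).injective (hc.matching _ _ _ h h' (congrArg e hyz))

theorem cnt_map (A : Finset V₁) (v : V₁) (q : Fin κ) :
    cnt H φ (A.map e) (e v) q = cnt (H.comap (liftEmb κ e)) (φ ∘ e) A v q := by
  unfold cnt
  rw [Finset.filter_map, Finset.card_map]
  rfl

theorem dg_map (A : Finset V₁) (v : V₁) : dg G (A.map e) (e v) = dg (G.comap e) A v := by
  unfold dg
  rw [Finset.filter_map, Finset.card_map]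
  rfl

theorem exists_map_eq {B : Finset V₁} {C : Finset V} (h : C ⊆ B.map e) : ∃ A ⊆ B, C = A.map e := by
  refine ⟨{x ∈ B | e x ∈ C}, Finset.filter_subset _ _, ?_⟩
  ext x
  simp only [Finset.mem_map, Finset.mem_filter]
  constructor
  · intro hx
    obtain ⟨y, hy, rfl⟩ := Finset.mem_map.1 (h hx)
    exact ⟨y, ⟨hy, hx⟩, rfl⟩
  · rintro ⟨y, ⟨-, hy⟩, rfl⟩
    exact hy

theorem Crit.comap [Nonempty (Fin κ)] {B : Finset V₁} (h : Crit G H g (B.map e)) :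
    Crit (G.comap e) (H.comap (liftEmb κ e)) (g ∘ liftEmb κ e) B where
  conn := by
    refine ⟨by simpa using h.conn.1, fun A hA hne hAB => ?_⟩
    obtain ⟨a, ha, b, hb, hb', hab⟩ := h.conn.2 (A.map e) (Finset.map_subset_map.2 hA)
      (by simpa using hne) (fun h' => hAB (Finset.map_injective e h'))
    obtain ⟨a, ha₁, rfl⟩ := Finset.mem_map.1 ha
    obtain ⟨b, hb₁, rfl⟩ := Finset.mem_map.1 hb
    exact ⟨a, ha₁, b, hb₁, fun h' => hb' (Finset.mem_map_of_mem e h'), hab⟩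
  valid := by
    intro v hv
    rw [← dg_map]
    exact h.valid (e v) (Finset.mem_map_of_mem e hv)
  bad := by
    rintro ⟨φ, hφ⟩
    apply h.bad
    refine ⟨Function.extend e φ fun _ => Classical.arbitrary _, fun C hC hne => ?_⟩
    obtain ⟨A, hA, rfl⟩ := exists_map_eq e hC
    obtain ⟨v, hv, hlt⟩ := hφ A hA (by simpa using hne)
    refine ⟨e v, Finset.mem_map_of_mem e hv, ?_⟩
    rw [cnt_map, Function.extend_comp e.injective, e.injective.extend_apply]
    exact hlt

theorem eq_map_comap_sup {V₂ : Type*} (e₂ : V₂ ↪ V) {K : SimpleGraph V}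
    (h : ∀ x y, K.Adj x y → (x ∈ Set.range e ∧ y ∈ Set.range e) ∨
      (x ∈ Set.range e₂ ∧ y ∈ Set.range e₂)) :
    K = (K.comap e).map e ⊔ (K.comap e₂).map e₂ := by
  ext x y
  rw [SimpleGraph.sup_adj, SimpleGraph.map_adj, SimpleGraph.map_adj]
  constructor
  · intro hxy
    rcases h x y hxy with ⟨⟨x, rfl⟩, ⟨y, rfl⟩⟩ | ⟨⟨x, rfl⟩, ⟨y, rfl⟩⟩
    · exact Or.inl ⟨x, y, hxy, rfl, rfl⟩
    · exact Or.inr ⟨x, y, hxy, rfl, rfl⟩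
  · rintro (⟨x, y, hxy, rfl, rfl⟩ | ⟨x, y, hxy, rfl, rfl⟩) <;> exact hxy

theorem range_liftEmb (κ : ℕ) {x : V × Fin κ} (h : x.1 ∈ Set.range e) :
    x ∈ Set.range (liftEmb κ e) := by
  obtain ⟨v, hv⟩ := h
  exact ⟨(v, x.2), Prod.ext hv rfl⟩

end Transfer

theorem exists_cut [Fintype V] (hconn : Conn G (univ : Finset V)) (hcard : 2 ≤ Fintype.card V)
    (hb : ¬ Block G (univ : Finset V)) : ∃ (w : V) (A B : Finset V), A.Nonempty ∧ B.Nonempty ∧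
      w ∉ A ∧ w ∉ B ∧ Disjoint A B ∧ insert w A ∪ B = univ ∧ ∀ a ∈ A, ∀ b ∈ B, ¬ G.Adj a b := by
  have : ∃ w, ¬ Conn G ((univ : Finset V).erase w) := by
    by_contra! hcon
    exact hb ⟨hconn, fun v _ => hcon v⟩
  obtain ⟨w, hw⟩ := this
  have hne : ((univ : Finset V).erase w).Nonempty := by
    rw [← Finset.card_pos, Finset.card_erase_of_mem (Finset.mem_univ w), Finset.card_univ]
    omega
  have : ∃ A ⊆ (univ : Finset V).erase w, A.Nonempty ∧ A ≠ univ.erase w ∧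
      ∀ a ∈ A, ∀ b ∈ (univ : Finset V).erase w, b ∉ A → ¬ G.Adj a b := by
    by_contra! hcon
    refine hw ⟨hne, fun A hA hAne hA' => ?_⟩
    obtain ⟨a, ha, b, hb, hbA, hab⟩ := hcon A hA hAne hA'
    exact ⟨a, ha, b, hb, hbA, hab⟩
  obtain ⟨A, hA, hAne, hA', hcl⟩ := this
  have hwA : w ∉ A := fun h => Finset.notMem_erase w _ (hA h)
  refine ⟨w, A, univ.erase w \ A, hAne, ?_, hwA, by simp, Finset.disjoint_sdiff, ?_, ?_⟩
  · exact Finset.sdiff_nonempty.2 fun h => hA' (hA.antisymm h)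
  · ext x
    simp only [Finset.mem_union, Finset.mem_insert, Finset.mem_sdiff, Finset.mem_erase,
      Finset.mem_univ, and_true, iff_true]
    tauto
  · intro a ha b hb
    exact hcl a ha b (Finset.mem_sdiff.1 hb).1 (Finset.mem_sdiff.1 hb).2

/-- Blocks are building covers, and both sides of a cut vertex are smaller with at least two
vertices. The bound `2 ≤ n` excludes a single vertex of value 0, which is critical but not a
building cover. -/
theorem Crit.constructible_aux [Nonempty (Fin κ)] (n : ℕ) : ∀ {V : Type u} [Fintype V]
    {G : SimpleGraph V} {H : SimpleGraph (V × Fin κ)} {f : V × Fin κ → ℕ},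
    Fintype.card V = n → 2 ≤ n → IsCover G H → Crit G H f univ → Constructible G H f := by
  induction n using Nat.strong_induction_on with
  | _ n ih =>
  intro V _ G H f hn h2 hc h
  by_cases hb : Block G (univ : Finset V)
  · exact Constructible.building (h.isBuildingCover hc hb)
  obtain ⟨w, A, B, hA, hB, hwA, hwB, hAB, hun, hno⟩ := exists_cut h.conn (hn ▸ h2) hb
  obtain ⟨f₁, f₂, h₁, h₂, hfw, hf₁, hf₂⟩ := h.exists_split hc hwA hwB hAB hun hno
  have hcard : #A + 1 + #B = n := by
    rw [← hn, ← Finset.card_univ, ← hun, Finset.card_union_of_disjoint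
      (Finset.disjoint_insert_left.2 ⟨hwB, hAB⟩), Finset.card_insert_of_notMem hwA]
  have hA0 := Finset.card_pos.2 hA
  have hB0 := Finset.card_pos.2 hB
  have hsub : ∀ {S : Finset V} {k : V × Fin κ → ℕ}, 2 ≤ #S → #S < n → Crit G H k S →
      Constructible (G.comap (Function.Embedding.subtype (· ∈ S)))
        (H.comap (liftEmb κ (Function.Embedding.subtype (· ∈ S))))
        (k ∘ liftEmb κ (Function.Embedding.subtype (· ∈ S))) := by
    intro S k hS hSn hk
    refine ih #S hSn (by simp) hS (hc.comap _) (Crit.comap _ ?_)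
    have : (univ : Finset {x // x ∈ S}).map (Function.Embedding.subtype (· ∈ S)) = S := by
      ext x
      simp
    rwa [this]
  have hcA : #(insert w A) = #A + 1 := Finset.card_insert_of_notMem hwA
  have hcB : #(insert w B) = #B + 1 := Finset.card_insert_of_notMem hwB
  have hmem : ∀ x, x = w ∨ x ∈ A ∨ x ∈ B := by
    intro x
    have := Finset.mem_univ x
    rw [← hun] at this
    simpa [or_assoc] using this
  have hr : ∀ S : Finset V, Set.range (Function.Embedding.subtype (· ∈ S)) = (S : Set V) := by
    intro S
    ext x
    simp
  have hside : ∀ x y, G.Adj x y → (x ∈ insert w A ∧ y ∈ insert w A) ∨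
      (x ∈ insert w B ∧ y ∈ insert w B) := by
    intro x y hxy
    have e₁ : x ∈ A → y ∈ B → False := fun hx hy => hno x hx y hy hxy
    have e₂ : y ∈ A → x ∈ B → False := fun hy hx => hno y hy x hx hxy.symm
    have := hmem x
    have := hmem y
    simp only [Finset.mem_insert]
    tauto
  refine Constructible.glue (⟨w, Finset.mem_insert_self w A⟩ : {x // x ∈ insert w A})
    (⟨w, Finset.mem_insert_self w B⟩ : {x // x ∈ insert w B}) w
    (Function.Embedding.subtype (· ∈ insert w A)) (Function.Embedding.subtype (· ∈ insert w B))
    (hsub (by omega) (by omega) h₁) (hsub (by omega) (by omega) h₂) rfl rfl ?_ ?_ ?_ ?_ hfw ?_ ?_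
  · rw [hr, hr]
    ext x
    have := hmem x
    simp only [Set.mem_union, Finset.mem_coe, Finset.mem_insert, Set.mem_univ, iff_true]
    tauto
  · rw [hr, hr]
    ext x
    have e₁ : x ∈ A → x ∉ B := fun h => Finset.disjoint_left.1 hAB h
    simp only [Set.mem_inter_iff, Finset.mem_coe, Finset.mem_insert, Set.mem_singleton_iff]
    tauto
  · apply eq_map_comap_sup
    intro x y hxy
    rw [hr, hr]
    exact hside x y hxy
  · apply eq_map_comap_sup
    intro x y hxy
    rcases hside x.1 y.1 (hc.adj_base _ _ hxy) with h' | h'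
    · exact Or.inl ⟨range_liftEmb _ _ (by rw [hr]; exact h'.1),
        range_liftEmb _ _ (by rw [hr]; exact h'.2)⟩
    · exact Or.inr ⟨range_liftEmb _ _ (by rw [hr]; exact h'.1),
        range_liftEmb _ _ (by rw [hr]; exact h'.2)⟩
  · rintro ⟨v, hv⟩ q hvw
    exact hf₁ v ((Finset.mem_insert.1 hv).resolve_left fun h' => hvw (Subtype.ext h')) q
  · rintro ⟨v, hv⟩ q hvw
    exact hf₂ v ((Finset.mem_insert.1 hv).resolve_left fun h' => hvw (Subtype.ext h')) q

theorem Crit.constructible [Fintype V] [Nonempty (Fin κ)] (hc : IsCover G H)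
    (h : Crit G H f univ) (hf : ∃ x, f x ≠ 0) : Constructible G H f := by
  refine Crit.constructible_aux _ rfl ?_ hc h
  by_contra hcard
  obtain ⟨⟨v, q⟩, hx⟩ := hf
  have h1 := h.sum_eq hc (Finset.mem_univ v)
  have h2 : dg G univ v = 0 := by
    unfold dg
    rw [Finset.card_eq_zero, Finset.filter_eq_empty_iff]
    intro u _ hvu
    exact hcard (Fintype.one_lt_card_iff.2 ⟨v, u, hvu.ne⟩)
  rw [h2, Finset.sum_eq_zero_iff] at h1
  exact hx (h1 q (Finset.mem_univ q))

/-! ### Translation from graphs and transversals to finite sets and choice functions. -/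

theorem conn_of_connected [Fintype V] (hG : G.Connected) : Conn G (univ : Finset V) := by
  have := hG.nonempty
  refine ⟨Finset.univ_nonempty, ?_⟩
  rintro A - ⟨a, ha⟩ hA
  obtain ⟨b, -, hb⟩ := Finset.exists_of_ssubset ((Finset.subset_univ A).ssubset_of_ne hA)
  obtain ⟨p⟩ := hG.preconnected a b
  obtain ⟨d, -, hd₁, hd₂⟩ := p.exists_boundary_dart (A : Set V) (by simpa using ha)
    (by simpa using hb)
  exact ⟨d.fst, by simpa using hd₁, d.snd, Finset.mem_univ _, by simpa using hd₂, d.adj⟩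

/-- Only induced subgraphs matter, as degrees in a subgraph are at most those in the subgraph
induced on its vertices. -/
theorem exists_transversal_iff [Fintype V] :
    (∃ R, IsStrictlyDegenerateTransversal H f R) ↔ Colorable H f univ := by
  constructor
  · rintro ⟨R, hR, hdeg⟩
    have : ∀ v, ∃ q, (v, q) ∈ R := by
      intro v
      obtain ⟨⟨u, q⟩, hx⟩ := Set.ncard_eq_one.1 (hR v)
      have hx' : (u, q) ∈ R ∩ fiber κ v := hx ▸ rfl
      obtain ⟨h₁, rfl⟩ := hx'
      exact ⟨q, h₁⟩
    choose φ hφ using this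
    refine ⟨φ, fun A _ ⟨a, ha⟩ => ?_⟩
    let s : Set R := {x | x.1.1 ∈ A ∧ x.1.2 = φ x.1.1}
    obtain ⟨⟨⟨v, q⟩, hx⟩, ⟨hv, hq⟩, hlt⟩ := hdeg ((⊤ : (H.induce R).Subgraph).induce s)
      ⟨⟨(a, φ a), hφ a⟩, ha, rfl⟩
    obtain rfl : q = φ v := hq
    refine ⟨v, hv, lt_of_le_of_lt ?_ hlt⟩
    rw [cnt, ← Set.ncard_coe_finset]
    refine le_trans (Set.ncard_le_ncard ?_ (Set.toFinite _))
      (Set.ncard_image_le (f := fun y : R => y.1.1) (Set.toFinite _))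
    intro u hu
    obtain ⟨hu, hvu⟩ := Finset.mem_filter.1 (Finset.mem_coe.1 hu)
    exact ⟨⟨(u, φ u), hφ u⟩, ⟨⟨hv, rfl⟩, ⟨hu, rfl⟩, hvu⟩, rfl⟩
  · rintro ⟨φ, hφ⟩
    refine ⟨{x | x.2 = φ x.1}, ?_, ?_⟩
    · intro v
      rw [Set.ncard_eq_one]
      refine ⟨(v, φ v), ?_⟩
      ext ⟨u, q⟩
      simp only [fiber, Set.mem_inter_iff, Set.mem_ofPred_eq, Set.mem_singleton_iff, Prod.mk.injEq]
      constructor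
      · rintro ⟨rfl, rfl⟩
        exact ⟨rfl, rfl⟩
      · rintro ⟨rfl, rfl⟩
        exact ⟨rfl, rfl⟩
    · rintro Γ ⟨⟨⟨a, q⟩, hq⟩, ha⟩
      obtain rfl : q = φ a := hq
      obtain ⟨v, hv, hlt⟩ := hφ {u | ⟨(u, φ u), rfl⟩ ∈ Γ.verts} (Finset.subset_univ _)
        ⟨a, by simpa using ha⟩
      refine ⟨⟨(v, φ v), rfl⟩, by simpa using hv, lt_of_le_of_lt ?_ hlt⟩
      rw [cnt, ← Set.ncard_coe_finset, ← Set.ncard_image_of_injective (f :=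
        fun y : {x : V × Fin κ | x.2 = φ x.1} => y.1.1)]
      · apply Set.ncard_le_ncard _ (Set.toFinite _)
        rintro _ ⟨⟨⟨u, q⟩, hq⟩, hu, rfl⟩
        obtain rfl : q = φ u := hq
        simp only [Finset.coe_filter, Set.mem_ofPred_eq, Finset.mem_filter, Finset.mem_univ,
          true_and]
        exact ⟨Γ.edge_vert hu.symm, Γ.adj_sub hu⟩
      · rintro ⟨⟨u, q⟩, hq⟩ ⟨⟨u', q'⟩, hq'⟩ (rfl : u = u')
        obtain rfl : q = φ u := hq
        obtain rfl : q' = φ u := hq'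
        rfl

end

/-! ### Constructible covers have no transversal. -/

section

variable {f : V × Fin κ → ℕ} {n : ℕ}

theorem cnt_add_le {B C : Finset V} (h : ∀ u ∈ B, u ∈ C → u = v) :
    cnt H φ B v (φ v) + cnt H φ C v (φ v) ≤ cnt H φ (B ∪ C) v (φ v) := by
  unfold cnt
  rw [Finset.filter_union, Finset.card_union_of_disjoint]
  rw [Finset.disjoint_left]
  intro u hu hu'
  obtain rfl := h u (Finset.mem_filter.1 hu).1 (Finset.mem_filter.1 hu').1
  exact H.irrefl (Finset.mem_filter.1 hu).2

theorem cnt_map_le {V₁ : Type*} (e : V₁ ↪ V) {H₁ : SimpleGraph (V₁ × Fin κ)}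
    (h : H₁.map (liftEmb κ e) ≤ H) (φ : V → Fin κ) (A : Finset V₁) (v : V₁) (q : Fin κ) :
    cnt H₁ (φ ∘ e) A v q ≤ cnt H φ (A.map e) (e v) q := by
  rw [cnt_map]
  apply Finset.card_le_card
  intro u hu
  obtain ⟨hu, hvu⟩ := Finset.mem_filter.1 hu
  exact Finset.mem_filter.2 ⟨hu, h ((SimpleGraph.map_adj _ _ _ _).2 ⟨_, _, hvu, rfl, rfl⟩)⟩

/-- A bad set of one side that misses the glued vertex stays bad. Otherwise the bad sets of both
sides are united: at `w` the values add, and so do the counts, since the two images share only `w`.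
Ranging over all finite `S` avoids a `Fintype` structure on the pieces. -/
theorem not_good_glue {V₁ V₂ : Type*} {H₁ : SimpleGraph (V₁ × Fin κ)} {f₁ : V₁ × Fin κ → ℕ}
    {H₂ : SimpleGraph (V₂ × Fin κ)} {f₂ : V₂ × Fin κ → ℕ} {w₁ : V₁} {w₂ : V₂}
    {e₁ : V₁ ↪ V} {e₂ : V₂ ↪ V} (h₁ : ¬ ∃ φ, ∀ S, Good H₁ f₁ φ S)
    (h₂ : ¬ ∃ φ, ∀ S, Good H₂ f₂ φ S) (hw₁ : e₁ w₁ = w) (hw₂ : e₂ w₂ = w)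
    (hinter : Set.range e₁ ∩ Set.range e₂ = {w})
    (hH : H = H₁.map (liftEmb κ e₁) ⊔ H₂.map (liftEmb κ e₂))
    (hfw : ∀ q, f (w, q) = f₁ (w₁, q) + f₂ (w₂, q))
    (hf₁ : ∀ v q, v ≠ w₁ → f (e₁ v, q) = f₁ (v, q))
    (hf₂ : ∀ v q, v ≠ w₂ → f (e₂ v, q) = f₂ (v, q)) : ¬ ∃ φ, ∀ S, Good H f φ S := by
  rintro ⟨φ, hφ⟩
  have hle₁ : H₁.map (liftEmb κ e₁) ≤ H := hH ▸ le_sup_left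
  have hle₂ : H₂.map (liftEmb κ e₂) ≤ H := hH ▸ le_sup_right
  have hbad₁ : ∃ A : Finset V₁, A.Nonempty ∧
      ∀ v ∈ A, f₁ (v, φ (e₁ v)) ≤ cnt H φ (A.map e₁) (e₁ v) (φ (e₁ v)) := by
    by_contra! hcon
    refine h₁ ⟨φ ∘ e₁, fun S A _ hne => ?_⟩
    obtain ⟨v, hv, hlt⟩ := hcon A hne
    exact ⟨v, hv, (cnt_map_le e₁ hle₁ φ A v _).trans_lt hlt⟩
  have hbad₂ : ∃ A : Finset V₂, A.Nonempty ∧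
      ∀ v ∈ A, f₂ (v, φ (e₂ v)) ≤ cnt H φ (A.map e₂) (e₂ v) (φ (e₂ v)) := by
    by_contra! hcon
    refine h₂ ⟨φ ∘ e₂, fun S A _ hne => ?_⟩
    obtain ⟨v, hv, hlt⟩ := hcon A hne
    exact ⟨v, hv, (cnt_map_le e₂ hle₂ φ A v _).trans_lt hlt⟩
  obtain ⟨A₁, hne₁, hA₁⟩ := hbad₁
  obtain ⟨A₂, hne₂, hA₂⟩ := hbad₂
  by_cases hwA₁ : w₁ ∈ A₁
  · by_cases hwA₂ : w₂ ∈ A₂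
    · obtain ⟨x, hx, hlt⟩ := hφ _ (A₁.map e₁ ∪ A₂.map e₂) subset_rfl
        (by simp [hne₁])
      have hlt' : ¬ f (x, φ x) ≤ cnt H φ (A₁.map e₁ ∪ A₂.map e₂) x (φ x) := not_le.2 hlt
      apply hlt'
      by_cases hxw : x = w
      · subst hxw
        have h₁' := hA₁ w₁ hwA₁
        have h₂' := hA₂ w₂ hwA₂
        rw [hw₁] at h₁'
        rw [hw₂] at h₂'
        rw [hfw]
        refine (Nat.add_le_add h₁' h₂').trans (cnt_add_le fun u hu hu' => ?_)
        have : u ∈ Set.range e₁ ∩ Set.range e₂ := by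
          obtain ⟨a, -, rfl⟩ := Finset.mem_map.1 hu
          obtain ⟨b, -, hb⟩ := Finset.mem_map.1 hu'
          exact ⟨⟨a, rfl⟩, ⟨b, hb⟩⟩
        rw [hinter] at this
        exact this
      · rcases Finset.mem_union.1 hx with h' | h'
        · obtain ⟨v, hv, rfl⟩ := Finset.mem_map.1 h'
          rw [hf₁ v _ (by rintro rfl; exact hxw hw₁)]
          exact (hA₁ v hv).trans (cnt_mono Finset.subset_union_left _ _)
        · obtain ⟨v, hv, rfl⟩ := Finset.mem_map.1 h'
          rw [hf₂ v _ (by rintro rfl; exact hxw hw₂)]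
          exact (hA₂ v hv).trans (cnt_mono Finset.subset_union_right _ _)
    · obtain ⟨x, hx, hlt⟩ := hφ _ (A₂.map e₂) subset_rfl (by simpa using hne₂)
      obtain ⟨v, hv, rfl⟩ := Finset.mem_map.1 hx
      rw [hf₂ v _ (by rintro rfl; exact hwA₂ hv)] at hlt
      exact absurd (hA₂ v hv) (not_le.2 hlt)
  · obtain ⟨x, hx, hlt⟩ := hφ _ (A₁.map e₁) subset_rfl (by simpa using hne₁)
    obtain ⟨v, hv, rfl⟩ := Finset.mem_map.1 hx
    rw [hf₁ v _ (by rintro rfl; exact hwA₁ hv)] at hlt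
    exact absurd (hA₁ v hv) (not_le.2 hlt)

/-- The kernel vertex over `v` chosen by `φ`. -/
def kernelSection (f : V × Fin κ → ℕ) (φ : V → Fin κ) (h : ∀ v, 0 < f (v, φ v)) (v : V) : support f :=
  ⟨(v, φ v), (h v).ne'⟩

/-- The chosen vertices are as many as the kernel vertices, so they exhaust the kernel. Their graph
lies inside `G` and has equally many edges, so it is `G`; each value is the full degree, and the
whole vertex set is bad. -/
theorem KernelIsBase.not_good [Fintype V] [Nonempty V] (hdeg : ∀ v, ∑ q, f (v, q) = deg G v)
    (hc : IsCover G H) (h : KernelIsBase G H f) : ¬ Good H f φ univ := by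
  intro hφ
  obtain ⟨ι⟩ := h
  have hpos : ∀ v, 0 < f (v, φ v) := fun v => hφ.pos (Finset.mem_univ v)
  have hinj : Function.Injective (kernelSection f φ hpos) := fun u v huv =>
    congrArg (fun x : support f => x.1.1) huv
  have hbij : Function.Bijective (kernelSection f φ hpos) :=
    (Fintype.bijective_iff_injective_and_card _).2 ⟨hinj, (Fintype.card_congr ι.toEquiv).symm⟩
  let K : SimpleGraph V := (kernel H f).comap (kernelSection f φ hpos)
  have hK : K ≤ G := fun u v huv => hc.adj_base _ _ huv
  have hiso : K ≃g G := RelIso.trans ⟨Equiv.ofBijective _ hbij, Iff.rfl⟩ ι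
  have hKG : K = G := by
    rw [← SimpleGraph.edgeFinset_inj]
    apply Finset.eq_of_subset_of_card_le (SimpleGraph.edgeFinset_mono hK)
    rw [hiso.card_edgeFinset_eq]
  have hzero : ∀ v q, q ≠ φ v → f (v, q) = 0 := by
    intro v q hq
    by_contra hx
    obtain ⟨u, hu⟩ := hbij.2 ⟨(v, q), hx⟩
    have h₁ : (u, φ u) = (v, q) := congrArg Subtype.val hu
    simp only [Prod.mk.injEq] at h₁
    obtain ⟨rfl, rfl⟩ := h₁
    exact hq rfl
  obtain ⟨v, -, hlt⟩ := hφ univ subset_rfl Finset.univ_nonempty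
  have h₁ := hdeg v
  rw [Finset.sum_eq_single (φ v) (fun q _ hq => hzero v q hq) (by simp), deg_eq_dg] at h₁
  have h₂ : cnt H φ univ v (φ v) = dg K univ v := rfl
  rw [hKG] at h₂
  omega

/-- Pigeonhole: the layer values sum to at most the degree of `v₀`, which is less than the number of
chosen vertices. Some layer contains more chosen vertices than its value, and these form a clique,
hence a bad set. -/
theorem KernelIsLayeredComplete.not_good [Fintype V] (hdeg : ∀ v, ∑ q, f (v, q) = deg G v)
    (hc : IsCover G H) (h : KernelIsLayeredComplete G H f) : ¬ Good H f φ univ := by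
  intro hφ
  obtain ⟨p, k, hp, ⟨η⟩, ⟨ι⟩, hconst⟩ := h
  have hpos : ∀ v, 0 < f (v, φ v) := fun v => hφ.pos (Finset.mem_univ v)
  let s := kernelSection f φ hpos
  have hV : Fintype.card V = p := by
    rw [Fintype.card_congr η.toEquiv, Fintype.card_fin]
  have hadj : ∀ x y : support f, (ι x).2 = (ι y).2 → x ≠ y → H.Adj x.1 y.1 := by
    intro x y hxy hne
    have : (layeredComplete p k).Adj (ι x) (ι y) := by
      simp only [layeredComplete, SimpleGraph.boxProd_adj, SimpleGraph.top_adj]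
      refine Or.inl ⟨fun h' => hne (ι.injective (Prod.ext h' hxy)), hxy⟩
    exact (ι.map_rel_iff (a := x) (b := y)).1 this
  have hfeq : ∀ x y : support f, (ι x).2 = (ι y).2 → f x.1 = f y.1 := by
    intro x y hxy
    by_cases hne : x = y
    · rw [hne]
    · exact hconst x y (SimpleGraph.Adj.reachable (G := kernel H f) (hadj x y hxy hne))
  let v₀ : V := η.symm ⟨0, by omega⟩
  -- The `p` vertices of a layer are pairwise adjacent, so they lie over distinct vertices and one
  -- of them lies over `v₀`.
  have hlayer : ∀ i : Fin k, ∃ q, ∃ hq : f (v₀, q) ≠ 0, (ι ⟨(v₀, q), hq⟩).2 = i := by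
    intro i
    have hinj : Function.Injective fun j : Fin p => (ι.symm (j, i)).1.1 := by
      intro j j' hjj
      by_contra hne
      have := hadj (ι.symm (j, i)) (ι.symm (j', i)) (by simp) (by simpa using hne)
      exact (hc.adj_base _ _ this).ne hjj
    obtain ⟨j, hj⟩ := ((Fintype.bijective_iff_injective_and_card _).2
      ⟨hinj, by rw [hV, Fintype.card_fin]⟩).2 v₀
    have hx : (ι.symm (j, i)).1 = (v₀, (ι.symm (j, i)).1.2) := Prod.ext hj rfl
    refine ⟨(ι.symm (j, i)).1.2, hx ▸ (ι.symm (j, i)).2, ?_⟩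
    have : (⟨(v₀, (ι.symm (j, i)).1.2), hx ▸ (ι.symm (j, i)).2⟩ : support f) = ι.symm (j, i) :=
      Subtype.ext hx.symm
    rw [this]
    simp
  choose r hr hri using hlayer
  have hrinj : Function.Injective r := by
    intro i i' hii
    rw [← hri i, ← hri i']
    simp only [hii]
  have hlt : ∑ i, f (v₀, r i) < ∑ i : Fin k, #{v | (ι (s v)).2 = i} := by
    rw [← Finset.card_eq_sum_card_fiberwise (f := fun v => (ι (s v)).2) (t := univ)
      (s := (univ : Finset V)) (by simp)]
    calc ∑ i, f (v₀, r i) = ∑ q ∈ univ.image r, f (v₀, q) :=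
          (Finset.sum_image (f := fun q => f (v₀, q)) hrinj.injOn).symm
      _ ≤ ∑ q, f (v₀, q) := Finset.sum_le_sum_of_subset (Finset.subset_univ _)
      _ = dg G univ v₀ := by rw [hdeg, deg_eq_dg]
      _ < #(univ : Finset V) := by
          apply Finset.card_lt_card
          rw [Finset.ssubset_univ_iff]
          intro h'
          have := Finset.mem_univ v₀
          rw [← h'] at this
          exact G.irrefl (Finset.mem_filter.1 this).2
  obtain ⟨i, -, hi⟩ := Finset.exists_lt_of_sum_lt hlt
  obtain ⟨v, hv, hlt⟩ := hφ ({v | (ι (s v)).2 = i} : Finset V) (Finset.subset_univ _)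
    (Finset.card_pos.1 (by omega))
  have hvi : (ι (s v)).2 = i := (Finset.mem_filter.1 hv).2
  have h₁ : f (v, φ v) = f (v₀, r i) := hfeq (s v) ⟨_, hr i⟩ (by rw [hvi, hri])
  have h₂ : #(({v | (ι (s v)).2 = i} : Finset V).erase v) ≤
      cnt H φ ({v | (ι (s v)).2 = i} : Finset V) v (φ v) := by
    apply Finset.card_le_card
    intro u hu
    obtain ⟨huv, hu⟩ := Finset.mem_erase.1 hu
    refine Finset.mem_filter.2 ⟨hu, hadj (s v) (s u) ?_ ?_⟩
    · rw [hvi, (Finset.mem_filter.1 hu).2]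
    · exact fun h' => huv (congrArg (fun x : support f => x.1.1) h').symm
  rw [Finset.card_erase_of_mem hv] at h₂
  omega

theorem Good.not_adj (hφ : Good H f φ S) (hone : ∀ x ∈ support f, f x = 1) (hu : u ∈ S)
    (hv : v ∈ S) : ¬ H.Adj (v, φ v) (u, φ u) := by
  intro h
  obtain ⟨x, hx, hlt⟩ := hφ {v, u} (by simp [Finset.insert_subset_iff, hu, hv]) (by simp)
  have hxS : x ∈ S := by
    rcases Finset.mem_insert.1 hx with rfl | hx
    · exact hv
    · rwa [Finset.mem_singleton.1 hx]
  rw [hone _ (hφ.pos hxS).ne'] at hlt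
  have : 0 < cnt H φ {v, u} x (φ x) := by
    rcases Finset.mem_insert.1 hx with rfl | hx
    · exact cnt_pos (u := u) (by simp) h
    · rw [Finset.mem_singleton.1 hx]
      exact cnt_pos (u := v) (by simp) h.symm
  omega

/-- An independent set is disjoint from its shift by one step. -/
theorem two_mul_card_le_of_indep_cycle {P : Finset (Fin n)}
    (h : ∀ i ∈ P, ∀ j ∈ P, ¬ (SimpleGraph.cycleGraph n).Adj i j) (hn : n ≠ 1) :
    2 * #P ≤ n := by
  let σ : Fin n → Fin n := fun i => ⟨if i.val + 1 = n then 0 else i.val + 1, by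
    have := i.2
    split_ifs <;> omega⟩
  have hσ : Function.Injective σ := by
    intro i j hij
    have hi := i.2
    have hj := j.2
    simp only [σ, Fin.mk.injEq] at hij
    apply Fin.ext
    split_ifs at hij <;> omega
  have hadj : ∀ i, (SimpleGraph.cycleGraph n).Adj i (σ i) := by
    intro i
    rw [cycleGraph_adj_iff_val]
    refine ⟨hn, ?_⟩
    simp only [σ]
    split_ifs <;> omega
  have hd : Disjoint P (P.map ⟨σ, hσ⟩) := by
    rw [Finset.disjoint_left]
    intro i hi hi'
    obtain ⟨j, hj, rfl⟩ := Finset.mem_map.1 hi'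
    exact h j hj _ hi (hadj j)
  have := Finset.card_le_univ (P ∪ P.map ⟨σ, hσ⟩)
  rw [Finset.card_union_of_disjoint hd, Finset.card_map, Fintype.card_fin] at this
  omega

/-- The chosen vertices are independent, so each of the two odd cycles holds at most `(n - 1) / 2`
of them, too few for `n` in total. -/
theorem KernelIsCircularLadder.not_good [Fintype V] (h : KernelIsCircularLadder G H f) :
    ¬ Good H f φ univ := by
  intro hφ
  obtain ⟨n, hn, hodd, ⟨η⟩, ⟨ι⟩, hone⟩ := h
  have hpos : ∀ v, 0 < f (v, φ v) := fun v => hφ.pos (Finset.mem_univ v)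
  let s := kernelSection f φ hpos
  have hV : #(univ : Finset V) = n := by
    rw [Finset.card_univ, Fintype.card_congr η.toEquiv, Fintype.card_fin]
  have hA : ∀ j : Fin 2, 2 * #{v | (ι (s v)).2 = j} ≤ n := by
    intro j
    have hcard : #(({v | (ι (s v)).2 = j} : Finset V).image fun v => (ι (s v)).1) =
        #{v | (ι (s v)).2 = j} := by
      apply Finset.card_image_of_injOn
      intro u hu v hv huv
      have hu : (ι (s u)).2 = j := by simpa using hu
      have hv : (ι (s v)).2 = j := by simpa using hv
      have := ι.injective (Prod.ext huv (hu.trans hv.symm))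
      exact congrArg (fun x : support f => x.1.1) this
    rw [← hcard]
    apply two_mul_card_le_of_indep_cycle _ (by omega)
    intro a ha b hb hab
    obtain ⟨u, hu, rfl⟩ := Finset.mem_image.1 ha
    obtain ⟨v, hv, rfl⟩ := Finset.mem_image.1 hb
    have : (circularLadder n).Adj (ι (s u)) (ι (s v)) := by
      simp only [circularLadder, SimpleGraph.boxProd_adj]
      exact Or.inl ⟨hab, (Finset.mem_filter.1 hu).2.trans (Finset.mem_filter.1 hv).2.symm⟩
    exact hφ.not_adj hone (Finset.mem_univ v) (Finset.mem_univ u)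
      ((ι.map_rel_iff (a := s u) (b := s v)).1 this)
  have hsum := Finset.card_eq_sum_card_fiberwise (f := fun v => (ι (s v)).2)
    (t := (univ : Finset (Fin 2))) (s := (univ : Finset V)) (by simp)
  rw [Fin.sum_univ_two, hV] at hsum
  have h₀ := hA 0
  have h₁ := hA 1
  obtain ⟨m, rfl⟩ := hodd
  omega

theorem isCyc_of_iso (hn : 3 ≤ n) (η : G ≃g SimpleGraph.cycleGraph n) :
    IsCyc G (fun i => η.symm ⟨i % n, Nat.mod_lt _ (by omega)⟩) n := by
  refine ⟨hn, fun i hi j hj hij => ?_, fun i hi j hj => ?_⟩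
  · have := congrArg Fin.val (η.symm.injective hij)
    simpa [Nat.mod_eq_of_lt hi, Nat.mod_eq_of_lt hj] using this
  · rw [η.symm.map_rel_iff, cycleGraph_adj_iff_val]
    simp only [Nat.mod_eq_of_lt hi, Nat.mod_eq_of_lt hj]
    omega

theorem deg_le_two_of_iso [Fintype V] (hn : 3 ≤ n) (η : G ≃g SimpleGraph.cycleGraph n) (v : V) :
    deg G v ≤ 2 := by
  have hcyc := isCyc_of_iso hn η
  have hu : cyc (fun i => η.symm ⟨i % n, Nat.mod_lt _ (by omega)⟩) n = univ := by
    ext v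
    simp only [Finset.mem_univ, iff_true]
    have := mem_cyc (c := fun i => η.symm ⟨i % n, Nat.mod_lt _ (by omega)⟩) (η v).2
    simpa [Nat.mod_eq_of_lt (η v).2] using this
  have := hcyc.dg_le (v := v) (hu ▸ Finset.mem_univ v)
  rwa [hu, ← deg_eq_dg] at this

/-- A walk without immediate reversals in a cycle of length `n` closes after `n` steps. -/
theorem cycleGraph_walk_periodic (b : ℕ → Fin n)
    (hadj : ∀ t, (SimpleGraph.cycleGraph n).Adj (b t) (b (t + 1))) (hne : ∀ t, b (t + 2) ≠ b t)
    (t : ℕ) : b (t + n) = b t := by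
  let z : ℕ → ZMod n := fun t => ((b t).val : ZMod n)
  have hz : ∀ s t, z s = z t → b s = b t := by
    intro s t hst
    have := (ZMod.natCast_eq_natCast_iff' _ _ _).1 hst
    rw [Nat.mod_eq_of_lt (b s).2, Nat.mod_eq_of_lt (b t).2] at this
    exact Fin.ext this
  have hstep : ∀ t, z (t + 1) = z t + 1 ∨ z (t + 1) = z t - 1 := by
    intro t
    have hcast : ∀ i : ℕ, i + 1 = n → ((i : ℕ) : ZMod n) = -1 := by
      intro i hi
      have : ((i + 1 : ℕ) : ZMod n) = 0 := by rw [hi, ZMod.natCast_self]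
      push_cast at this
      exact eq_neg_of_add_eq_zero_left this
    rcases ((cycleGraph_adj_iff_val _ _).1 (hadj t)).2 with h | h | ⟨h₁, h₂⟩ | ⟨h₁, h₂⟩
    · left
      simp only [z, ← h]
      push_cast
      rfl
    · right
      simp only [z, ← h]
      push_cast
      ring
    · right
      simp only [z]
      rw [hcast _ h₂, h₁]
      push_cast
      ring
    · left
      simp only [z]
      rw [hcast _ h₂, h₁]
      push_cast
      ring
  -- Steps are `1` or `-1`, and a change of sign would be a reversal. The step is thus constant, and
  -- `n` of them sum to zero.
  have hd : ∀ t, z (t + 1) = z t + (z 1 - z 0) := by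
    intro t
    induction t with
    | zero => ring
    | succ t ih =>
      have hne' : z (t + 2) ≠ z t := fun h => hne t (hz _ _ h)
      have h₁ := hstep t
      have h₂ : z (t + 2) = z (t + 1) + 1 ∨ z (t + 2) = z (t + 1) - 1 := hstep (t + 1)
      change z (t + 2) = z (t + 1) + (z 1 - z 0)
      have h₃ : z 1 - z 0 = z (t + 1) - z t := by rw [ih]; ring
      rw [h₃]
      rcases h₁ with h₁ | h₁ <;> rcases h₂ with h₂ | h₂ <;> rw [h₁] at h₂ ⊢ <;> rw [h₂] at hne' ⊢
      · ring
      · exact absurd (by ring) hne'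
      · exact absurd (by ring) hne'
      · ring
  have hall : ∀ m, z (t + m) = z t + m * (z 1 - z 0) := by
    intro m
    induction m with
    | zero => simp
    | succ m ih =>
      rw [← add_assoc, hd, ih]
      push_cast
      ring
  apply hz
  rw [hall, ZMod.natCast_self, zero_mul, add_zero]

/-- The kernel is a single cycle of length `2 * n`, and by `cycleGraph_walk_periodic` antipodal
vertices lie in the same fibre. Exactly one of each antipodal pair is chosen, and no two consecutive
vertices are. -/
theorem KernelIsMobiusLadder.not_good [Fintype V] (hdeg : ∀ v, ∑ q, f (v, q) = deg G v)
    (hc : IsCover G H) (h : KernelIsMobiusLadder G H f) : ¬ Good H f φ univ := by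
  intro hφ
  obtain ⟨n, hn, heven, ⟨η⟩, ⟨ι⟩, hone⟩ := h
  have hpos : ∀ v, 0 < f (v, φ v) := fun v => hφ.pos (Finset.mem_univ v)
  let s := kernelSection f φ hpos
  let y : ℕ → Fin n × Fin 2 := fun t =>
    (⟨t % n, Nat.mod_lt _ (by omega)⟩, ⟨t / n % 2, Nat.mod_lt _ (by omega)⟩)
  let x : ℕ → support f := fun t => ι.symm (y t)
  have hsucc : ∀ t, (t % n + 1 < n ∧ (t + 1) % n = t % n + 1 ∧ (t + 1) / n = t / n) ∨
      (t % n + 1 = n ∧ (t + 1) % n = 0 ∧ (t + 1) / n = t / n + 1) := by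
    intro t
    have hlt := Nat.mod_lt t (show 0 < n by omega)
    have hdm := Nat.div_add_mod t n
    by_cases h' : t % n + 1 = n
    · right
      have : t + 1 = n * (t / n + 1) := by
        rw [Nat.mul_add]
        omega
      refine ⟨h', ?_, ?_⟩
      · rw [this, Nat.mul_mod_right]
      · conv_lhs => rw [this, Nat.mul_div_cancel_left _ (by omega : 0 < n)]
    · left
      have h₁ : t + 1 = t % n + 1 + n * (t / n) := by omega
      have h₂ : t % n + 1 < n := by omega
      refine ⟨h₂, ?_, ?_⟩
      · conv_lhs => rw [h₁, Nat.add_mul_mod_self_left, Nat.mod_eq_of_lt h₂]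
      · conv_lhs => rw [h₁, Nat.add_mul_div_left _ _ (by omega : 0 < n), Nat.div_eq_of_lt h₂,
          zero_add]
  have hadj : ∀ t, H.Adj (x t).1 (x (t + 1)).1 := by
    intro t
    have : (mobiusLadder n).Adj (y t) (y (t + 1)) := by
      simp only [mobiusLadder, SimpleGraph.fromRel_adj, y, ne_eq, Prod.mk.injEq, Fin.mk.injEq]
      have := hsucc t
      omega
    exact (ι.symm.map_rel_iff (a := y t) (b := y (t + 1))).2 this
  have hne2 : ∀ t, x (t + 2) ≠ x t := by
    intro t h'
    have := ι.symm.injective h'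
    simp only [y, Prod.mk.injEq, Fin.mk.injEq] at this
    have h₁ := hsucc t
    have h₂ := hsucc (t + 1)
    simp only [Nat.add_assoc, Nat.reduceAdd] at h₂
    omega
  have hnen : ∀ t, x (t + n) ≠ x t := by
    intro t h'
    have := ι.symm.injective h'
    simp only [y, Prod.mk.injEq, Fin.mk.injEq, Nat.add_div_right t (show 0 < n by omega)] at this
    omega
  have hbase : ∀ t, (x (t + n)).1.1 = (x t).1.1 := by
    intro t
    apply η.injective
    refine cycleGraph_walk_periodic (fun t => η (x t).1.1) ?_ ?_ t
    · exact fun t => η.map_rel_iff.2 (hc.adj_base _ _ (hadj t))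
    · intro t h'
      exact hne2 t (Subtype.ext (hc.matching _ _ _ (hadj (t + 1)) (hadj t).symm (η.injective h')))
  let M : ℕ → Prop := fun t => s (x t).1.1 = x t
  have hM₁ : ∀ t, M t ∨ M (t + n) := by
    intro t
    have hsum : ∑ q, f ((x t).1.1, q) ≤ 2 := by
      rw [hdeg]
      exact deg_le_two_of_iso hn η _
    have hxn : (x (t + n)).1 = ((x t).1.1, (x (t + n)).1.2) := Prod.ext (hbase t) rfl
    have hq : (x t).1.2 ≠ (x (t + n)).1.2 := fun h' =>
      hnen t (Subtype.ext (Prod.ext (hbase t) h'.symm))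
    rcases eq_or_eq_of_sum_le_two hsum hq (Nat.pos_of_ne_zero (x t).2)
      (Nat.pos_of_ne_zero (hxn ▸ (x (t + n)).2)) (hpos (x t).1.1) with h' | h'
    · exact Or.inl (Subtype.ext (Prod.ext rfl h'))
    · right
      refine Subtype.ext (Prod.ext rfl ?_)
      change φ (x (t + n)).1.1 = _
      rw [hbase, h']
  have hM₂ : ∀ t, M t → ¬ M (t + n) := by
    intro t h₁ h₂
    apply hnen t
    rw [← h₁, ← h₂, hbase]
  have hM₃ : ∀ t, M t → ¬ M (t + 1) := by
    intro t h₁ h₂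
    have := hadj t
    rw [← h₁, ← h₂] at this
    exact hφ.not_adj hone (Finset.mem_univ _) (Finset.mem_univ _) this
  -- Choosing index `t` excludes `t + 1`, forces `t + 1 + n`, excludes `t + 2 + n` and so forces `t
  -- + 2`. For even `n` this reaches the antipode of `t`, a contradiction.
  have hM₄ : ∀ t, M t → M (t + 2) := by
    intro t h₁
    have h₂ := (hM₁ (t + 1)).resolve_left (hM₃ t h₁)
    by_contra h₃
    have h₄ := (hM₁ (t + 2)).resolve_left h₃
    apply hM₃ _ h₂
    rwa [show t + 1 + n + 1 = t + 2 + n by ring]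
  have hM₅ : ∀ m t, M t → M (t + 2 * m) := by
    intro m
    induction m with
    | zero => exact fun t h => h
    | succ m ih =>
      intro t h'
      have := hM₄ _ (ih t h')
      rwa [show t + 2 * m + 2 = t + 2 * (m + 1) by ring] at this
  obtain ⟨m, hm⟩ := heven
  have hM₆ : ∀ t, ¬ M t := by
    intro t h'
    apply hM₂ t h'
    rw [hm, ← two_mul]
    exact hM₅ m t h'
  rcases hM₁ 0 with h' | h'
  · exact hM₆ _ h'
  · exact hM₆ _ h'

theorem IsBuildingCover.not_good [Fintype V] [Nonempty V] (h : IsBuildingCover G H f) :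
    ¬ Good H f φ univ := by
  rcases h.type with h' | h' | h' | h'
  · exact h'.not_good h.degree h.cover
  · exact h'.not_good h.degree h.cover
  · exact h'.not_good
  · exact h'.not_good h.degree h.cover

theorem Constructible.not_good (h : Constructible G H f) :
    Nonempty V → ¬ ∃ φ, ∀ S, Good H f φ S := by
  induction h with
  | building h =>
    rintro hV ⟨φ, hφ⟩
    have := h.finite
    have := Fintype.ofFinite
    exact h.not_good (hφ univ)
  | glue w₁ w₂ w e₁ e₂ _ _ hw₁ hw₂ _ hinter _ hH hfw hf₁ hf₂ ih₁ ih₂ =>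
    exact fun _ => not_good_glue (ih₁ ⟨w₁⟩) (ih₂ ⟨w₂⟩) hw₁ hw₂ hinter hH hfw hf₁ hf₂

end

end CoverDegeneracy

theorem mainTheorem1 {V : Type*} [Finite V] {κ : ℕ} (G : SimpleGraph V) (hG : G.Connected)
    (H : SimpleGraph (V × Fin κ)) (hH : CoverDegeneracy.IsCover G H)
    (f : V × Fin κ → ℕ) (hf : ∃ x, f x ≠ 0)
    (hdeg : ∀ v : V, CoverDegeneracy.deg G v ≤ ∑ q : Fin κ, f (v, q)) :
    (∃ R : Set (V × Fin κ), CoverDegeneracy.IsStrictlyDegenerateTransversal H f R) ↔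
      ¬ CoverDegeneracy.Constructible G H f := by
  have := Fintype.ofFinite V
  have : Nonempty (Fin κ) := ⟨hf.choose.2⟩
  rw [CoverDegeneracy.exists_transversal_iff]
  constructor
  · rintro ⟨φ, hφ⟩ hcon
    exact hcon.not_good hG.nonempty ⟨φ, fun S => hφ.mono (Finset.subset_univ S)⟩
  · intro hcon
    by_contra hbad
    refine hcon (CoverDegeneracy.Crit.constructible hH
      ⟨CoverDegeneracy.conn_of_connected hG, fun v _ => ?_, hbad⟩ hf)
    rw [← CoverDegeneracy.deg_eq_dg]
    exact hdeg v
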